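/- **Setting.** Let $\mathbb{H}^d=\{x\in\mathbb{R}^{d+1}:\langle x,x\rangle=-1,\ x_0>0\}$ be hyperbolic space of curvature $-1$ in the hyperboloid model, where $\langle x,y\rangle=-x_0y_0+\sum_{i=1}^d x_iy_i$, $T_x\mathbb{H}^d=\{v:\langle x,v\rangle=0\}$ and $\mathrm{dist}(x,y)=\operatorname{arcosh}(-\langle x,y\rangle)$. Write $\exp_x$ for the exponential map, $\log_x$ for its inverse and $P_{x\to y}$ for parallel transport along the geodesic from $x$ to $y$. For tangent vectors $(x_i,v_i)$ put $\mathrm{gspan}(x_1,\dots,x_m,v_1,\dots,v_m)=\mathbb{H}^d\cap\mathrm{span}(x_1,\dots,x_m,v_1,\dots,v_m)$. A function $f:\mathbb{H}^d\to\mathbb{R}$ is g-convex if it is convex along geodesics, and $g\in T_x\mathbb{H}^d$ is a subgradient of $f$ at $x$ if $f(y)\ge f(x)+\langle g,\log_x(y)\rangle$ for all $y$. A deterministic first-order algorithm $\mathcal{A}$ is a sequence of maps $\mathcal{A}_k:(\mathbb{R}\times T\mathbb{H}^d)^k\to\mathbb{H}^d$, $k\ge 0$; an oracle for $f$ is a map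 $\mathcal{O}$ which sends each $x$ to the pair of $f(x)$ and a subgradient of $f$ at $x$; running $\mathcal{A}$ with $\mathcal{O}$ produces $x_k=\mathcal{A}_k(\mathcal{O}(x_0),\dots,\mathcal{O}(x_{k-1}))$, and $g_k$ denotes the subgradient returned at $x_k$. **Parameters.** Let $r>0$, $M>0$, $0<\epsilon\le\frac{1}{4\sqrt2}$, $\zeta_r=r/\tanh r$, and $T=d=\lfloor\frac{\zeta_r}{32\epsilon^2}\rfloor$. Let $\theta\in(0,\frac{\pi}{2})$ be given by $\epsilon=\frac14\cos\theta$. **Construction.** Let $x_{\mathrm{ref}}\in\mathbb{H}^d$ and let $e_1,\dots,e_d$ be an orthonormal basis of $T_{x_{\mathrm{ref}}}\mathbb{H}^d$. Put $r_0=r$, $y_0=x_{\mathrm{ref}}$, $e_i^{(0)}=e_i$, and let $S_0$ be the sphere of radius $r$ around $y_0$. For $k=1,\dots,d-1$ define $\Delta_{k-1},r_k>0$ by $\tanh\Delta_{k-1}=\cos\theta\tanh r_{k-1}$ and $\sinh r_k=\sin\theta\sinh r_{k-1}$, and put $y_k=\exp_{y_{k-1}}(\Delta_{k-1}e_k^{(k-1)})$,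 $e_i^{(k)}=P_{y_{k-1}\to y_k}e_i^{(k-1)}$, and $$S_k=\{x\in S_{k-1}:\ \text{the angle between } e_k^{(k-1)} \text{ and } \log_{y_{k-1}}(x) \text{ is } \theta\}.$$ For $x^*\in S_{d-1}$ and $k=0,\dots,d-2$ let $$V_k=\frac{1}{\cos\theta}e_{k+1}^{(k)}-\frac{\log_{y_k}(x^*)}{\mathrm{dist}(y_k,x^*)},\qquad L_k=\exp_{y_k}(\{v\in T_{y_k}\mathbb{H}^d:\langle V_k,v\rangle\ge0\}),$$ $$f(x)=\frac{M\cos\theta}{2}\Big[\mathrm{dist}(x,x^*)+\max_{0\le i\le d-2}\frac{1}{\cos\theta}\,\mathrm{dist}(x,L_i)\Big],$$ where the maximum is read as $0$ if $d=1$. (For $M=\frac{2}{\cos\theta}$ the factor in front is $1$.) **Theorem.** The set $S_{d-1}$ is nonempty. For every $x^*\in S_{d-1}$, the function $f$ is globally g-convex and globally $M$-Lipschitz, its minimum $f^*$ over $\mathbb{H}^d$ is attained at $x^*$, and there is an oracle $\mathcal{O}$ for $f$ with the following two properties. * For $0\le k\le d-2$ and every $x\in\mathrm{gspan}(y_0,\dots,y_k)\cap\bigcap_{\ell<k}L_\ell$,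 the subgradient which $\mathcal{O}$ returns at $x$ is tangent to $\mathrm{gspan}(y_0,\dots,y_{k+1})$. * Let $\mathcal{A}$ be a deterministic first-order algorithm whose run with $\mathcal{O}$ satisfies (A1) $x_0=x_{\mathrm{ref}}$ and $x_k\in\mathrm{gspan}(x_0,\dots,x_{k-1},g_0,\dots,g_{k-1})$ for all $k\ge1$, and (A2) $x_k\in\bigcap_{\ell=0}^{k-1}L_\ell$ for all $k\le d-1$. Then $f(x_k)-f^*\ge\epsilon Mr$ for all $k=0,\dots,T-1$. -/

import Mathlib

namespace HypOpt

noncomputable section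

/-! # The hyperboloid model of hyperbolic space of curvature `-1` -/

/-- The ambient space `ℝ^{d+1}` of the hyperboloid model, with coordinates `0, 1, …, d`. -/
abbrev Vec (d : ℕ) := Fin (d + 1) → ℝ

/-- The Lorentz form `⟨x, y⟩ = xᵀ J y` with `J = diag(-1, 1, …, 1)`. -/
def lor {d : ℕ} (x y : Vec d) : ℝ := -(x 0 * y 0) + ∑ i : Fin d, x i.succ * y i.succ

/-- Hyperbolic space `ℍ^d`: the upper sheet of the hyperboloid `⟨x, x⟩ = -1`. -/
@[ext]
structure Hyp (d : ℕ) where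
  coords : Vec d
  lor_self : lor coords coords = -1
  pos : 0 < coords 0

theorem lor_comm {d : ℕ} (x y : Vec d) : lor x y = lor y x := by
  simp only [lor, mul_comm]

theorem lor_add_left {d : ℕ} (x y z : Vec d) : lor (x + y) z = lor x z + lor y z := by
  simp only [lor, Pi.add_apply, add_mul, Finset.sum_add_distrib]; ring

theorem lor_smul_left {d : ℕ} (c : ℝ) (x z : Vec d) : lor (c • x) z = c * lor x z := by
  simp only [lor, Pi.smul_apply, smul_eq_mul, mul_add, Finset.mul_sum, mul_assoc]; ring

theorem lor_add_right {d : ℕ} (x y z : Vec d) : lor x (y + z) = lor x y + lor x z := by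
  rw [lor_comm, lor_add_left, lor_comm y, lor_comm z]

theorem lor_smul_right {d : ℕ} (c : ℝ) (x z : Vec d) : lor x (c • z) = c * lor x z := by
  rw [lor_comm, lor_smul_left, lor_comm]

theorem lor_cauchy {d : ℕ} (x y : Vec d) :
    (lor x y + x 0 * y 0) ^ 2 ≤ (lor x x + x 0 ^ 2) * (lor y y + y 0 ^ 2) := by
  have h := Finset.sum_mul_sq_le_sq_mul_sq Finset.univ
    (fun i : Fin d => x i.succ) (fun i : Fin d => y i.succ)
  have e1 : lor x y + x 0 * y 0 = ∑ i : Fin d, x i.succ * y i.succ := by simp [lor]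
  have e2 : lor x x + x 0 ^ 2 = ∑ i : Fin d, x i.succ ^ 2 := by simp [lor, sq]
  have e3 : lor y y + y 0 ^ 2 = ∑ i : Fin d, y i.succ ^ 2 := by simp [lor, sq]
  rw [e1, e2, e3]; exact h

theorem lor_le_neg_one {d : ℕ} (x y : Hyp d) : lor x.coords y.coords ≤ -1 := by
  have h := lor_cauchy x.coords y.coords
  rw [x.lor_self, y.lor_self] at h
  have hx1 : 0 ≤ lor x.coords x.coords + x.coords 0 ^ 2 := by
    have : lor x.coords x.coords + x.coords 0 ^ 2 = ∑ i : Fin d, x.coords i.succ ^ 2 := by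
      simp [lor, sq]
    rw [this]; exact Finset.sum_nonneg fun i _ => sq_nonneg _
  have hy1 : 0 ≤ lor y.coords y.coords + y.coords 0 ^ 2 := by
    have : lor y.coords y.coords + y.coords 0 ^ 2 = ∑ i : Fin d, y.coords i.succ ^ 2 := by
      simp [lor, sq]
    rw [this]; exact Finset.sum_nonneg fun i _ => sq_nonneg _
  rw [x.lor_self] at hx1
  rw [y.lor_self] at hy1
  have px := x.pos
  have py := y.pos
  have gx : 1 ≤ x.coords 0 := by nlinarith
  have gy : 1 ≤ y.coords 0 := by nlinarith
  have hp : 1 ≤ x.coords 0 * y.coords 0 := by nlinarith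
  have key : (lor x.coords y.coords + x.coords 0 * y.coords 0) ^ 2
      ≤ (x.coords 0 * y.coords 0 - 1) ^ 2 := by
    nlinarith [sq_nonneg (x.coords 0 - y.coords 0)]
  have := abs_le_of_sq_le_sq' key (by linarith)
  linarith [this.2]

theorem lor_self_nonneg {d : ℕ} (x : Hyp d) {v : Vec d} (hv : lor x.coords v = 0) :
    0 ≤ lor v v := by
  have h := lor_cauchy x.coords v
  rw [hv, x.lor_self, zero_add] at h
  have px := x.pos
  have hv1 : 0 ≤ lor v v + v 0 ^ 2 := by
    have : lor v v + v 0 ^ 2 = ∑ i : Fin d, v i.succ ^ 2 := by simp [lor, sq]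
    rw [this]; exact Finset.sum_nonneg fun i _ => sq_nonneg _
  by_contra hneg
  push Not at hneg
  have : 0 < x.coords 0 ^ 2 := by positivity
  nlinarith

theorem pos_of_lor_neg {d : ℕ} (x : Hyp d) {z : Vec d} (hz : lor z z = -1)
    (h : lor x.coords z < 0) : 0 < z 0 := by
  by_contra hneg
  push Not at hneg
  have hc := lor_cauchy x.coords z
  rw [hz, x.lor_self] at hc
  have hz1 : 0 ≤ lor z z + z 0 ^ 2 := by
    have : lor z z + z 0 ^ 2 = ∑ i : Fin d, z i.succ ^ 2 := by simp [lor, sq]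
    rw [this]; exact Finset.sum_nonneg fun i _ => sq_nonneg _
  rw [hz] at hz1
  have px := x.pos
  have h1 : 0 ≤ x.coords 0 * (-z 0) := mul_nonneg px.le (by linarith)
  have h2 : (lor x.coords z + x.coords 0 * z 0) ^ 2 ≤ (x.coords 0 * (-z 0)) ^ 2 := by
    nlinarith [sq_nonneg (x.coords 0)]
  have := abs_le_of_sq_le_sq' h2 h1
  nlinarith [this.1]

/-- The tangent space `T_x ℍ^d = {v : ⟨x, v⟩ = 0}`; its inner product is the Lorentz form. -/
def Tan {d : ℕ} (x : Hyp d) : Submodule ℝ (Vec d) where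
  carrier := {v | lor x.coords v = 0}
  add_mem' := by
    intro a b ha hb
    simp only [Set.mem_ofPred_eq] at *
    rw [lor_add_right, ha, hb, add_zero]
  zero_mem' := by simp [lor]
  smul_mem' := by
    intro c a ha
    simp only [Set.mem_ofPred_eq] at *
    rw [lor_smul_right, ha, mul_zero]

theorem mem_Tan {d : ℕ} {x : Hyp d} {v : Vec d} : v ∈ Tan x ↔ lor x.coords v = 0 := Iff.rfl

/-- The tangent bundle `Tℍ^d`. -/
abbrev TBundle (d : ℕ) := Σ x : Hyp d, Tan x

/-- The Riemannian inner product on `T_x ℍ^d`. -/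
def tinner {d : ℕ} {x : Hyp d} (u v : Tan x) : ℝ := lor (u : Vec d) (v : Vec d)

/-- The Riemannian norm on `T_x ℍ^d`. -/
def tnorm {d : ℕ} {x : Hyp d} (v : Tan x) : ℝ := Real.sqrt (tinner v v)

theorem tnorm_sq {d : ℕ} {x : Hyp d} (v : Tan x) : tnorm v ^ 2 = lor (v : Vec d) (v : Vec d) :=
  Real.sq_sqrt (lor_self_nonneg x v.2)

/-- The angle in `[0, π]` between two tangent vectors at the same point. -/
def tangle {d : ℕ} {x : Hyp d} (u v : Tan x) : ℝ :=
  Real.arccos (tinner u v / (tnorm u * tnorm v))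

/-- The Riemannian distance of `ℍ^d`, `dist(x, y) = arcosh (-⟨x, y⟩)`. -/
def hdist {d : ℕ} (x y : Hyp d) : ℝ := Real.arcosh (-lor x.coords y.coords)

/-- The distance from a point to a (nonempty) set. -/
def hdistSet {d : ℕ} (x : Hyp d) (S : Set (Hyp d)) : ℝ := sInf (hdist x '' S)

/-- The coordinates of `exp_x v`; at `v = 0` the quotient is `0` and the value is `x`. -/
def expVec {d : ℕ} (x : Hyp d) (v : Tan x) : Vec d :=
  Real.cosh (tnorm v) • x.coords + (Real.sinh (tnorm v) / tnorm v) • (v : Vec d)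

theorem lor_expVec_left {d : ℕ} (x : Hyp d) (v : Tan x) :
    lor x.coords (expVec x v) = -Real.cosh (tnorm v) := by
  have hv : lor x.coords (v : Vec d) = 0 := v.2
  rw [expVec, lor_add_right, lor_smul_right, lor_smul_right, x.lor_self, hv]; ring

theorem lor_expVec_self {d : ℕ} (x : Hyp d) (v : Tan x) :
    lor (expVec x v) (expVec x v) = -1 := by
  have hv : lor x.coords (v : Vec d) = 0 := v.2
  have hv' : lor (v : Vec d) x.coords = 0 := by rw [lor_comm]; exact hv
  have hn := tnorm_sq v
  have hc := Real.cosh_sq (tnorm v)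
  simp only [expVec, lor_add_left, lor_add_right, lor_smul_left, lor_smul_right, x.lor_self,
    hv, hv', ← hn]
  by_cases h0 : tnorm v = 0
  · simp [h0]
  · field_simp
    linear_combination (-tnorm v) * hc

/-- The exponential map `exp_x v = cosh ‖v‖ x + (sinh ‖v‖ / ‖v‖) v`. -/
def hexp {d : ℕ} (x : Hyp d) (v : Tan x) : Hyp d where
  coords := expVec x v
  lor_self := lor_expVec_self x v
  pos := pos_of_lor_neg x (lor_expVec_self x v) (by
    rw [lor_expVec_left]; linarith [Real.cosh_pos (tnorm v)])

/-- The inverse `log_x` of the exponential map,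
`log_x y = (D / sinh D) (y - cosh D x)` with `D = dist(x, y)`. -/
def hlog {d : ℕ} (x y : Hyp d) : Tan x :=
  ⟨(hdist x y / Real.sinh (hdist x y)) • (y.coords + (-Real.cosh (hdist x y)) • x.coords), by
    rw [mem_Tan, lor_smul_right, lor_add_right, lor_smul_right, x.lor_self, hdist,
      Real.cosh_arcosh (by linarith [lor_le_neg_one x y])]
    ring⟩

/-- Parallel transport `P_{x → y}` along the geodesic from `x` to `y`,
`P u = u + (⟨y, u⟩ / (1 - ⟨x, y⟩)) (x + y)`: it fixes the tangent vectors orthogonal to the geodesic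
and sends its unit tangent `w` at `x` to `sinh (dist(x, y)) x + cosh (dist(x, y)) w`. -/
def transport {d : ℕ} (x y : Hyp d) (u : Tan x) : Tan y :=
  ⟨(u : Vec d) + (lor y.coords (u : Vec d) / (1 - lor x.coords y.coords)) •
      (x.coords + y.coords), by
    have h : 1 - lor x.coords y.coords ≠ 0 := by
      have := lor_le_neg_one x y
      intro h; linarith
    rw [mem_Tan, lor_add_right, lor_smul_right, lor_add_right, y.lor_self,
      lor_comm y.coords x.coords]
    field_simp
    ring⟩

/-- The linear span in `ℝ^{d+1}` of the points and of the vectors of a set of tangent vectors. -/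
def linSpan {d : ℕ} (Z : Set (TBundle d)) : Submodule ℝ (Vec d) :=
  Submodule.span ℝ ((fun z : TBundle d => z.1.coords) '' Z ∪
    (fun z : TBundle d => (z.2 : Vec d)) '' Z)

/-- `gspan(x₁, …, x_m, v₁, …, v_m) = ℍ^d ∩ span(x₁, …, x_m, v₁, …, v_m)`. -/
def gspan {d : ℕ} (Z : Set (TBundle d)) : Set (Hyp d) := {x | x.coords ∈ linSpan Z}

/-! # Convex analysis on hyperbolic space -/

/-- Geodesic convexity on `ℍ^d`: convexity along each geodesic `t ↦ exp_x (t log_x y)`. -/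
def GConvex {d : ℕ} (f : Hyp d → ℝ) : Prop :=
  ∀ x y : Hyp d, ∀ t ∈ Set.Icc (0 : ℝ) 1,
    f (hexp x (t • hlog x y)) ≤ (1 - t) * f x + t * f y

/-- Global `M`-Lipschitz continuity for the Riemannian distance. -/
def GLipschitz {d : ℕ} (M : ℝ) (f : Hyp d → ℝ) : Prop :=
  ∀ x y : Hyp d, |f x - f y| ≤ M * hdist x y

/-- The subdifferential of `f` at `x`. -/
def subdiff {d : ℕ} (f : Hyp d → ℝ) (x : Hyp d) : Set (Tan x) :=
  {g | ∀ y : Hyp d, f x + tinner g (hlog x y) ≤ f y}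

/-- A deterministic first-order algorithm: from `k` answers of the oracle it computes the
`k`-th query. -/
abbrev Algorithm (d : ℕ) := (k : ℕ) → (Fin k → ℝ × TBundle d) → Hyp d

/-- `O` is an oracle for `f`: it returns the value and a subgradient at the queried point. -/
def IsOracle {d : ℕ} (f : Hyp d → ℝ) (O : Hyp d → ℝ × TBundle d) : Prop :=
  ∀ x, ∃ g ∈ subdiff f x, O x = (f x, ⟨x, g⟩)

/-- The iterates `x_k = A_k (O x₀, …, O x_{k-1})` of `A` run with the oracle `O`. -/
def iter {d : ℕ} (A : Algorithm d) (O : Hyp d → ℝ × TBundle d) (k : ℕ) : Hyp d :=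
  A k (fun l : Fin k => O (iter A O l))
termination_by k
decreasing_by exact l.2

/-- Along the run with `O`, the first query is `x₀` and every later query lies in
the gspan of the past queries and the past subgradients. -/
def QueriesInGspan {d : ℕ} (x₀ : Hyp d) (A : Algorithm d) (O : Hyp d → ℝ × TBundle d) : Prop :=
  iter A O 0 = x₀ ∧
    ∀ k, 1 ≤ k → iter A O k ∈ gspan ((fun l : ℕ => (O (iter A O l)).2) '' {l | l < k})

/-! # The geometric construction -/

/-- `ζ_r = r / tanh r`. -/
def zeta (r : ℝ) : ℝ := r / Real.tanh r

/-- The radii: `r₀ = r` and `sinh r_{k+1} = sin θ sinh r_k`. -/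
def radius (r θ : ℝ) : ℕ → ℝ
  | 0 => r
  | k + 1 => Real.arsinh (Real.sin θ * Real.sinh (radius r θ k))

/-- The step lengths: `tanh Δ_k = cos θ tanh r_k`. -/
def stepLen (r θ : ℝ) (k : ℕ) : ℝ := Real.artanh (Real.cos θ * Real.tanh (radius r θ k))

/-- The `(k+1)`-st vector of a frame `E₁, …, E_d`, indexed here by `0, …, d - 1`. -/
def frameVec {d : ℕ} {y : Hyp d} (E : Fin d → Tan y) (k : ℕ) : Tan y :=
  if h : k < d then E ⟨k, h⟩ else 0

/-- The points `y_k` with the frames `e_1^{(k)}, …, e_d^{(k)}` of `T_{y_k} ℍ^d`: the first pair is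
`(x₀, e)`, then `y_{k+1} = exp_{y_k} (Δ_k e_{k+1}^{(k)})`, and the frame is parallel transported
from `y_k` to `y_{k+1}`. -/
def stage {d : ℕ} (r θ : ℝ) (x₀ : Hyp d) (e : Fin d → Tan x₀) :
    ℕ → Σ y : Hyp d, (Fin d → Tan y)
  | 0 => ⟨x₀, e⟩
  | k + 1 =>
    let s := stage r θ x₀ e k
    let y' := hexp s.1 (stepLen r θ k • frameVec s.2 k)
    ⟨y', fun i => transport s.1 y' (s.2 i)⟩

/-- The point `y_k`. -/
def yPt {d : ℕ} (r θ : ℝ) (x₀ : Hyp d) (e : Fin d → Tan x₀) (k : ℕ) : Hyp d :=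
  (stage r θ x₀ e k).1

/-- The unit vector `e_{k+1}^{(k)}` at `y_k`. -/
def yDir {d : ℕ} (r θ : ℝ) (x₀ : Hyp d) (e : Fin d → Tan x₀) (k : ℕ) : Tan (yPt r θ x₀ e k) :=
  frameVec (stage r θ x₀ e k).2 k

/-- The points `y₀, …, y_k` (with zero tangent vectors). -/
def yPts {d : ℕ} (r θ : ℝ) (x₀ : Hyp d) (e : Fin d → Tan x₀) (k : ℕ) : Set (TBundle d) :=
  {z | ∃ i ≤ k, z = ⟨yPt r θ x₀ e i, 0⟩}

/-- The spheres: `S₀` is the sphere of radius `r` around `y₀ = x₀`, and `S_{k+1}` consists of the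
points `x` of `S_k` for which `log_{y_k} x` makes the angle `θ` with `e_{k+1}^{(k)}`. -/
def sphereSet {d : ℕ} (r θ : ℝ) (x₀ : Hyp d) (e : Fin d → Tan x₀) : ℕ → Set (Hyp d)
  | 0 => {x | hdist x₀ x = r}
  | k + 1 => {x | x ∈ sphereSet r θ x₀ e k ∧
      tangle (yDir r θ x₀ e k) (hlog (yPt r θ x₀ e k) x) = θ}

/-- The normal vector `V_k = (1 / cos θ) e_{k+1}^{(k)} - log_{y_k} x* / dist(y_k, x*)`. -/
def normalVec {d : ℕ} (r θ : ℝ) (x₀ : Hyp d) (e : Fin d → Tan x₀) (xs : Hyp d) (k : ℕ) :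
    Tan (yPt r θ x₀ e k) :=
  (1 / Real.cos θ) • yDir r θ x₀ e k -
    (1 / hdist (yPt r θ x₀ e k) xs) • hlog (yPt r θ x₀ e k) xs

/-- The half-space `L_k = exp_{y_k} {v : ⟨V_k, v⟩ ≥ 0}`. -/
def halfSpace {d : ℕ} (r θ : ℝ) (x₀ : Hyp d) (e : Fin d → Tan x₀) (xs : Hyp d) (k : ℕ) :
    Set (Hyp d) :=
  hexp (yPt r θ x₀ e k) '' {v | 0 ≤ tinner (normalVec r θ x₀ e xs k) v}

/-- The hard function `dist(x, x*) + max_{0 ≤ i ≤ d-2} (1 / cos θ) dist(x, L_i)`. For `d = 1` the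
maximum is over the empty set and is read as `0`. -/
def baseFun {d : ℕ} (r θ : ℝ) (x₀ : Hyp d) (e : Fin d → Tan x₀) (xs : Hyp d) (x : Hyp d) : ℝ :=
  hdist x xs +
    ⨆ i : Fin (d - 1), (1 / Real.cos θ) * hdistSet x (halfSpace r θ x₀ e xs i)

/-- The hard function scaled to the Lipschitz constant `M`; the factor is `1` for
`M = 2 / cos θ`. -/
def hardFun {d : ℕ} (M r θ : ℝ) (x₀ : Hyp d) (e : Fin d → Tan x₀) (xs : Hyp d) (x : Hyp d) : ℝ :=
  (M * Real.cos θ / 2) * baseFun r θ x₀ e xs x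

/-- Along the run with `O`, for `k ≤ d - 1` the query `x_k` lies in
`L₀ ∩ … ∩ L_{k-1}`. -/
def QueriesInHalfSpaces {d : ℕ} (r θ : ℝ) (x₀ : Hyp d) (e : Fin d → Tan x₀) (xs : Hyp d)
    (A : Algorithm d) (O : Hyp d → ℝ × TBundle d) : Prop :=
  ∀ k < d, ∀ l < k, iter A O k ∈ halfSpace r θ x₀ e xs l

end

end HypOpt

namespace HypOpt

/-! The construction is linear in the ambient space. Parallel transport leaves the unused frame
vectors unchanged in `ℝ^{d+1}` (`stage_frame`), so `S_k` is cut out of `S₀` by equations `⟨E_j, x⟩ =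
cos θ sinh r_j`, `j < k`, with `E_j` the frame vectors (`mem_sphereSet_iff`). Hence `cosh r_k y_k`
is the Lorentz projection of every `x* ∈ S_k` to `span(y₀, …, y_k)` (`lor_xs_of_mem_linSpan`), and
points of `gspan(y₀, …, y_k)` are at distance at least `r_k` from `x*` (`radius_le_hdist`).

The normal `V_k` is orthogonal to `x*` and to `span(y₀, …, y_k)`. So `f(x*) = 0`, and at a query in
`gspan(y₀, …, y_k) ∩ ⋂_{l<k} L_l` all half-space terms vanish while the query sits on the boundary
of `L_k`. There a multiple of `-V_k` may be added to the gradient of the distance to `x*`, and a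
suitable multiple cancels `x*`: the answer reveals `y_{k+1}` only
(`exists_mem_subdiff_baseFun_linSpan`). By induction the `k`-th query stays in `gspan(y₀, …, y_k)`.

It remains that `r_k ≥ r / 2` for `k < d` (`half_le_radius`), from `sinh r_k = sin^k θ sinh r`.
Convexity and the Lipschitz bound follow from a bounded subgradient at every point; the subgradient
inequalities reduce to scalar inequalities for `sinh` and `cosh`. -/

/-! ### Scalar inequalities behind the subgradients. -/

theorem sinh_mul_le {c b : ℝ} (hc0 : 0 ≤ c) (hc1 : c ≤ 1) (hb : 0 ≤ b) :
    Real.sinh (c * b) ≤ c * Real.sinh b := by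
  have hd : ∀ t : ℝ, HasDerivAt (fun t => c * Real.sinh t - Real.sinh (c * t))
      (c * Real.cosh t - Real.cosh (c * t) * c) t := by
    intro t
    have h1 := (Real.hasDerivAt_sinh t).const_mul c
    have h2 := ((hasDerivAt_id t).const_mul c).sinh
    exact (h1.sub h2).congr_deriv (by simp)
  have hmono : MonotoneOn (fun t => c * Real.sinh t - Real.sinh (c * t)) (Set.Ici 0) := by
    apply monotoneOn_of_deriv_nonneg (convex_Ici 0)
    · exact fun t _ => (hd t).continuousAt.continuousWithinAt
    · exact fun t _ => (hd t).differentiableAt.differentiableWithinAt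
    · intro t ht
      rw [interior_Ici] at ht
      have ht' : 0 < t := ht
      rw [(hd t).deriv]
      have : Real.cosh (c * t) ≤ Real.cosh t := by
        rw [Real.cosh_le_cosh, abs_of_nonneg (by positivity), abs_of_pos ht']
        nlinarith
      nlinarith
  have := hmono (Set.mem_Ici.2 le_rfl) (Set.mem_Ici.2 hb) hb
  simp only [Real.sinh_zero, mul_zero, sub_zero] at this
  linarith

/-- Comparison of the hyperbolic law of cosines with the first order expansion of the distance. -/
theorem cosh_sub_mul_le {c : ℝ} (hc : |c| ≤ 1) (a b : ℝ) :
    Real.cosh (a - b * c) ≤ Real.cosh a * Real.cosh b - c * (Real.sinh a * Real.sinh b) := by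
  -- Convexity of `exp` between `-b` and `b`, for `c` and `-c`; the claim is their sum with weights
  -- `exp (-a) / 2` and `exp a / 2`.
  have h1 := Real.exp_mul_le_cosh_add_mul_sinh hc b
  have h2 := Real.exp_mul_le_cosh_add_mul_sinh (t := -c) (by rwa [abs_neg]) b
  have e1 : Real.cosh (a - b * c) =
      (Real.exp a * Real.exp (-c * b) + Real.exp (-a) * Real.exp (c * b)) / 2 := by
    rw [Real.cosh_eq, ← Real.exp_add, ← Real.exp_add]; ring_nf
  have e2 : Real.cosh a * Real.cosh b - c * (Real.sinh a * Real.sinh b) =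
      (Real.exp a * (Real.cosh b + -c * Real.sinh b)
        + Real.exp (-a) * (Real.cosh b + c * Real.sinh b)) / 2 := by
    rw [Real.cosh_eq a, Real.sinh_eq a]; ring
  rw [e1, e2]
  gcongr

/-- `tanh` is concave on the positive half-line: `s tanh b ≤ tanh (s b)`. -/
theorem mul_sinh_mul_cosh_le {s b : ℝ} (hs0 : 0 ≤ s) (hs1 : s ≤ 1) (hb : 0 ≤ b) :
    s * (Real.sinh b * Real.cosh (b * s)) ≤ Real.sinh (b * s) * Real.cosh b := by
  -- By the addition formulas the claim is `(1 + s) sinh (b - bs) ≤ (1 - s) sinh (b + bs)`, which is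
  -- monotonicity of `sinh t / t`.
  have h := sinh_mul_le (c := (1 - s) / (1 + s)) (b := b * (1 + s))
    (div_nonneg (by linarith) (by linarith)) (by rw [div_le_one (by linarith)]; linarith)
    (mul_nonneg hb (by linarith))
  have hs : 1 + s ≠ 0 := by positivity
  have e : (1 - s) / (1 + s) * (b * (1 + s)) = b - b * s := by field_simp
  rw [e, show b * (1 + s) = b + b * s by ring] at h
  have h' : (1 + s) * Real.sinh (b - b * s) ≤ (1 - s) * Real.sinh (b + b * s) := by
    calc _ ≤ (1 + s) * ((1 - s) / (1 + s) * Real.sinh (b + b * s)) := by gcongr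
      _ = _ := by field_simp
  rw [Real.sinh_sub, Real.sinh_add] at h'
  nlinarith

/-- First order lower bound for the signed distance to a hyperplane along a geodesic. -/
theorem sinh_add_mul_le {a b c : ℝ} (ha : 0 ≤ a) (hb : 0 ≤ b) (hc : |c| ≤ 1)
    (hab : 0 ≤ a + b * c) :
    Real.sinh (a + b * c) ≤ Real.sinh a * Real.cosh b + c * (Real.cosh a * Real.sinh b) := by
  obtain ⟨hc1, hc2⟩ := abs_le.1 hc
  rcases le_total 0 c with h0 | h0
  · rw [Real.sinh_add]
    have h1 : Real.cosh (b * c) ≤ Real.cosh b := by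
      rw [Real.cosh_le_cosh, abs_of_nonneg (by positivity), abs_of_nonneg hb]
      nlinarith
    have h2 := sinh_mul_le h0 hc2 hb
    rw [mul_comm c b] at h2
    have h3 := Real.sinh_nonneg_iff.2 ha
    have h4 := Real.cosh_pos a
    nlinarith [mul_le_mul_of_nonneg_left h1 h3, mul_le_mul_of_nonneg_left h2 h4.le]
  -- With `a' = a + b c ≥ 0`, the right side is expanded in `sinh a'` and `cosh a'`: the first
  -- coefficient is at least `1` by `h1`, the second nonnegative by `h2`.
  · obtain ⟨s, rfl⟩ : ∃ s, c = -s := ⟨-c, by ring⟩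
    obtain ⟨a', rfl⟩ : ∃ a', a = a' + b * s := ⟨a - b * s, by ring⟩
    have ha' : 0 ≤ a' := by linarith
    have h1 := cosh_sub_mul_le (c := s) (by rwa [abs_neg] at hc) (b * s) b
    have h2 := mul_sinh_mul_cosh_le (s := s) (b := b) (by linarith) (by linarith) hb
    rw [sub_self, Real.cosh_zero] at h1
    have h3 := Real.sinh_nonneg_iff.2 ha'
    have h4 := Real.cosh_pos a'
    rw [show a' + b * s + b * -s = a' by ring, Real.sinh_add, Real.cosh_add]
    nlinarith [mul_le_mul_of_nonneg_left h1 h3, mul_le_mul_of_nonneg_left h2 h4.le]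

/-! ### How long the radii stay above `r / 2`. -/

theorem two_rpow_le_one_add_cosh {r : ℝ} (hr : 0 ≤ r) : (2 : ℝ) ^ r ≤ 1 + Real.cosh r := by
  -- Since `log 2 < 3/4`, it suffices that `u³ ≤ 1 + u⁴ / 2`.
  set u := Real.exp (r / 4) with hu
  have hu4 : Real.exp r = u ^ 4 := by rw [hu, ← Real.exp_nat_mul]; push_cast; ring_nf
  have hu3 : Real.exp (3 / 4 * r) = u ^ 3 := by rw [hu, ← Real.exp_nat_mul]; push_cast; ring_nf
  have h1 : (2 : ℝ) ^ r ≤ u ^ 3 := by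
    rw [← hu3, Real.rpow_def_of_pos two_pos, Real.exp_le_exp]
    have := Real.log_two_lt_d9
    nlinarith
  have h2 : u ^ 4 / 2 ≤ Real.cosh r := by
    rw [Real.cosh_eq, hu4]; have := Real.exp_pos (-r); linarith
  nlinarith [sq_nonneg (u ^ 2 - u - 3 / 4), sq_nonneg (u - 3 / 2), sq_nonneg u]

theorem zeta_le {r : ℝ} (hr : 0 < r) : zeta r ≤ 1 + r := by
  have hs := Real.sinh_pos_iff.2 hr
  have hc := Real.cosh_pos r
  rw [zeta, Real.tanh_eq_sinh_div_cosh, div_div_eq_mul_div, div_le_iff₀ hs]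
  have h1 : Real.cosh r - Real.sinh r ≤ 1 := by
    rw [Real.cosh_sub_sinh]; exact Real.exp_le_one_iff.2 (by linarith)
  have h2 := Real.self_le_sinh_iff.2 hr.le
  nlinarith

/-- Together with `cos² θ ≤ 1/2` this makes the dimension at least `1`. -/
theorem one_le_zeta {r : ℝ} (hr : 0 < r) : 1 ≤ zeta r := by
  have hs := Real.sinh_pos_iff.2 hr
  have hc := Real.cosh_pos r
  rw [zeta, Real.tanh_eq_sinh_div_cosh, div_div_eq_mul_div, le_div_iff₀ hs, one_mul]
  have hd : ∀ t : ℝ, HasDerivAt (fun t => t * Real.cosh t - Real.sinh t)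
      (t * Real.sinh t) t := by
    intro t
    have h1 := ((hasDerivAt_id t).mul (Real.hasDerivAt_cosh t)).sub (Real.hasDerivAt_sinh t)
    exact h1.congr_deriv (by simp)
  have hmono : MonotoneOn (fun t => t * Real.cosh t - Real.sinh t) (Set.Ici 0) := by
    apply monotoneOn_of_deriv_nonneg (convex_Ici 0)
    · exact fun t _ => (hd t).continuousAt.continuousWithinAt
    · exact fun t _ => (hd t).differentiableAt.differentiableWithinAt
    · intro t ht
      rw [interior_Ici] at ht
      have ht' : 0 < t := ht
      rw [(hd t).deriv]
      exact mul_nonneg ht'.le (Real.sinh_nonneg_iff.2 ht'.le)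
  have := hmono (Set.mem_Ici.2 le_rfl) (Set.mem_Ici.2 hr.le) hr.le
  simp only [Real.sinh_zero, sub_zero, zero_mul] at this
  linarith

theorem radius_pos {r θ : ℝ} (hr : 0 < r) (hs : 0 < Real.sin θ) (k : ℕ) : 0 < radius r θ k := by
  induction k with
  | zero => exact hr
  | succ k ih => exact Real.arsinh_pos_iff.2 (mul_pos hs (Real.sinh_pos_iff.2 ih))

theorem sinh_radius (r θ : ℝ) (k : ℕ) :
    Real.sinh (radius r θ k) = Real.sin θ ^ k * Real.sinh r := by
  induction k with
  | zero => simp [radius]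
  | succ k ih => rw [radius, Real.sinh_arsinh, ih]; ring

/-- The convex function `4^{-c}` meets the line `1 - c` at `c = 0` and `c = 1/2`, so it lies below
it in between. -/
theorem quarter_rpow_le {c : ℝ} (h0 : 0 ≤ c) (h1 : c ≤ 1 / 2) : (1 / 4 : ℝ) ^ c ≤ 1 - c := by
  have h := Real.geom_mean_le_arith_mean2_weighted (w₁ := 1 - 2 * c) (w₂ := 2 * c)
    (p₁ := 1) (p₂ := 1 / 2) (by linarith) (by linarith) (by norm_num) (by norm_num) (by ring)
  rw [Real.one_rpow, one_mul, Real.rpow_mul (by norm_num)] at h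
  norm_num at h ⊢
  linarith

/-- Within the first `ζ_r / (2 cos² θ)` stages the radius stays at least half of the initial one. -/
theorem half_le_radius {r θ : ℝ} (hr : 0 < r) (hs : 0 < Real.sin θ)
    (hc : Real.cos θ ^ 2 ≤ 1 / 2) {k : ℕ} (hk : k * (2 * Real.cos θ ^ 2) ≤ zeta r) :
    r / 2 ≤ radius r θ k := by
  -- As `sinh r = 2 sinh (r/2) cosh (r/2)`, the claim squares to `sin^{2k} θ · 4 cosh² (r/2) ≥ 1`.
  -- The first factor is at least `2^{-ζ}`, the second at least `2^ζ`.
  rw [← Real.sinh_le_sinh, sinh_radius]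
  have hr2 : Real.sinh r = 2 * Real.sinh (r / 2) * Real.cosh (r / 2) := by
    rw [← Real.sinh_two_mul]; ring_nf
  have hsp : 0 < Real.sinh (r / 2) := Real.sinh_pos_iff.2 (by linarith)
  have hcp := Real.cosh_pos (r / 2)
  have hch : Real.cosh r = 2 * Real.cosh (r / 2) ^ 2 - 1 := by
    have h1 := Real.cosh_two_mul (r / 2)
    have h2 := Real.cosh_sq (r / 2)
    rw [show 2 * (r / 2) = r by ring] at h1
    linarith
  have h1 : (2 : ℝ) ^ zeta r ≤ 4 * Real.cosh (r / 2) ^ 2 := by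
    calc (2 : ℝ) ^ zeta r ≤ 2 ^ (1 + r) :=
          Real.rpow_le_rpow_of_exponent_le (by norm_num) (zeta_le hr)
      _ = 2 * 2 ^ r := by rw [Real.rpow_add two_pos, Real.rpow_one]
      _ ≤ 2 * (1 + Real.cosh r) := by gcongr; exact two_rpow_le_one_add_cosh hr.le
      _ = _ := by rw [hch]; ring
  have h2 : ((2 : ℝ) ^ zeta r)⁻¹ ≤ (Real.sin θ ^ k) ^ 2 := by
    calc ((2 : ℝ) ^ zeta r)⁻¹ ≤ ((2 : ℝ) ^ ((k : ℝ) * (2 * Real.cos θ ^ 2)))⁻¹ := by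
          gcongr; norm_num
      _ = ((1 / 4 : ℝ) ^ (Real.cos θ ^ 2)) ^ k := by
          rw [← Real.rpow_mul_natCast (by norm_num), ← Real.inv_rpow (by norm_num),
            show (1 / 4 : ℝ) = (2⁻¹) ^ (2 : ℝ) by norm_num, ← Real.rpow_mul (by norm_num)]
          ring_nf
      _ ≤ (1 - Real.cos θ ^ 2) ^ k := by
          gcongr; exact quarter_rpow_le (sq_nonneg _) hc
      _ = _ := by rw [← Real.sin_sq]; ring
  have h3 : 1 ≤ (Real.sin θ ^ k * (2 * Real.cosh (r / 2))) ^ 2 := by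
    have hp : 0 < (2 : ℝ) ^ zeta r := by positivity
    calc (1 : ℝ) = ((2 : ℝ) ^ zeta r)⁻¹ * 2 ^ zeta r := (inv_mul_cancel₀ hp.ne').symm
      _ ≤ (Real.sin θ ^ k) ^ 2 * (4 * Real.cosh (r / 2) ^ 2) := by gcongr
      _ = _ := by ring
  have h4 : 1 ≤ Real.sin θ ^ k * (2 * Real.cosh (r / 2)) := by
    have hp : 0 ≤ Real.sin θ ^ k * (2 * Real.cosh (r / 2)) := by positivity
    nlinarith
  rw [hr2]
  nlinarith [mul_le_mul_of_nonneg_left h4 hsp.le]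

/-! ### The Lorentz form on tangent spaces. -/

variable {d : ℕ}

theorem lor_neg_left (x y : Vec d) : lor (-x) y = -lor x y := by
  rw [← neg_one_smul ℝ x, lor_smul_left]; ring

theorem lor_neg_right (x y : Vec d) : lor x (-y) = -lor x y := by
  rw [lor_comm, lor_neg_left, lor_comm]

theorem lor_sub_left (x y z : Vec d) : lor (x - y) z = lor x z - lor y z := by
  rw [sub_eq_add_neg, lor_add_left, lor_neg_left]; ring

theorem lor_sub_right (x y z : Vec d) : lor x (y - z) = lor x y - lor x z := by
  rw [lor_comm, lor_sub_left, lor_comm y, lor_comm z]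

theorem lor_zero_right (x : Vec d) : lor x 0 = 0 := by simp [lor]

theorem lor_zero_left (x : Vec d) : lor 0 x = 0 := by simp [lor]

/-- Cauchy-Schwarz on the spatial parts gives `x₀² v₀² ≤ (x₀² - 1) v₀²`, so the time coordinate of
`v` vanishes and the form is Euclidean on `v`. -/
theorem eq_zero_of_lor_self_eq_zero (x : Hyp d) {v : Vec d} (hv : lor x.coords v = 0)
    (h : lor v v = 0) : v = 0 := by
  have hc := lor_cauchy x.coords v
  rw [hv, h, x.lor_self] at hc
  have h0 : v 0 = 0 := by
    by_contra hne
    have : 0 < v 0 ^ 2 := by positivity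
    nlinarith
  have hs : ∑ i : Fin d, v i.succ * v i.succ = 0 := by
    have := h
    rw [lor, h0] at this
    linarith
  rw [Finset.sum_eq_zero_iff_of_nonneg fun i _ => mul_self_nonneg _] at hs
  funext i
  refine Fin.cases h0 (fun j => ?_) i
  simpa using hs j (Finset.mem_univ j)

theorem lor_sq_le (x : Hyp d) {u v : Vec d} (hu : lor x.coords u = 0) (hv : lor x.coords v = 0) :
    lor u v ^ 2 ≤ lor u u * lor v v := by
  have hA := lor_self_nonneg x hv
  rcases hA.eq_or_lt with h | h
  · rw [eq_zero_of_lor_self_eq_zero x hv h.symm]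
    simp [lor_zero_right]
  · have hw : lor x.coords (lor v v • u - lor u v • v) = 0 := by
      rw [lor_sub_right, lor_smul_right, lor_smul_right, hu, hv]; ring
    have hn := lor_self_nonneg x hw
    simp only [lor_sub_left, lor_sub_right, lor_smul_left, lor_smul_right, lor_comm v u] at hn
    have : 0 ≤ lor v v * (lor u u * lor v v - lor u v ^ 2) := by linarith
    have := (mul_nonneg_iff_of_pos_left h).1 this
    linarith

theorem abs_lor_le_one (x : Hyp d) {u v : Vec d} (hu : lor x.coords u = 0)
    (hv : lor x.coords v = 0) (hu1 : lor u u ≤ 1) (hv1 : lor v v ≤ 1) : |lor u v| ≤ 1 := by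
  have h := lor_sq_le x hu hv
  have h1 := lor_self_nonneg x hu
  have h2 := lor_self_nonneg x hv
  rw [← sq_le_one_iff_abs_le_one]
  nlinarith

/-! ### Distance, logarithm and geodesics in polar form. -/

theorem one_le_neg_lor (x y : Hyp d) : 1 ≤ -lor x.coords y.coords := by
  linarith [lor_le_neg_one x y]

theorem hdist_nonneg (x y : Hyp d) : 0 ≤ hdist x y := Real.arcosh_nonneg (one_le_neg_lor x y)

theorem cosh_hdist (x y : Hyp d) : Real.cosh (hdist x y) = -lor x.coords y.coords :=
  Real.cosh_arcosh (one_le_neg_lor x y)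

theorem lor_eq_neg_cosh_hdist (x y : Hyp d) :
    lor x.coords y.coords = -Real.cosh (hdist x y) := by
  rw [cosh_hdist, neg_neg]

theorem hdist_comm (x y : Hyp d) : hdist x y = hdist y x := by
  rw [hdist, hdist, lor_comm]

theorem hdist_self (x : Hyp d) : hdist x x = 0 := by
  rw [hdist, x.lor_self, neg_neg, Real.arcosh_zero]

theorem hdist_eq_of_cosh {x y : Hyp d} {b : ℝ} (hb : 0 ≤ b)
    (h : lor x.coords y.coords = -Real.cosh b) : hdist x y = b := by
  rw [hdist, h, neg_neg, Real.arcosh_cosh hb]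

/-- No sign condition on `b`: a first-order lower bound for the distance may be negative. -/
theorem le_hdist_of_cosh_le {x y : Hyp d} {b : ℝ}
    (h : Real.cosh b ≤ -lor x.coords y.coords) : b ≤ hdist x y := by
  rw [← cosh_hdist, Real.cosh_le_cosh, abs_of_nonneg (hdist_nonneg x y)] at h
  exact (le_abs_self b).trans h

theorem eq_of_hdist_eq_zero {x y : Hyp d} (h : hdist x y = 0) : x = y := by
  have hl := lor_eq_neg_cosh_hdist x y
  rw [h, Real.cosh_zero] at hl
  have h1 : lor x.coords (y.coords - x.coords) = 0 := by
    rw [lor_sub_right, hl, x.lor_self]; ring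
  have h2 : lor (y.coords - x.coords) (y.coords - x.coords) = 0 := by
    simp only [lor_sub_left, lor_sub_right, x.lor_self, y.lor_self, lor_comm y.coords, hl]; ring
  exact Hyp.ext (sub_eq_zero.1 (eq_zero_of_lor_self_eq_zero x h1 h2)).symm

/-- The geodesic with unit initial velocity `v` at `x`, followed for time `b`. -/
theorem hdist_of_polar {x y : Hyp d} {v : Vec d} {b : ℝ} (hb : 0 ≤ b)
    (hv : lor x.coords v = 0)
    (hy : y.coords = Real.cosh b • x.coords + Real.sinh b • v) : hdist x y = b := by
  apply hdist_eq_of_cosh hb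
  rw [hy, lor_add_right, lor_smul_right, lor_smul_right, x.lor_self, hv]; ring

theorem hlog_of_polar {x y : Hyp d} {v : Vec d} {b : ℝ} (hb : 0 ≤ b)
    (hv : lor x.coords v = 0)
    (hy : y.coords = Real.cosh b • x.coords + Real.sinh b • v) :
    (hlog x y : Vec d) = b • v := by
  have hd := hdist_of_polar hb hv hy
  simp only [hlog, hd]
  rcases hb.eq_or_lt with h | h
  · simp [← h]
  · have hs : Real.sinh b ≠ 0 := (Real.sinh_pos_iff.2 h).ne'
    rw [hy]
    have : Real.cosh b • x.coords + Real.sinh b • v + -Real.cosh b • x.coords = Real.sinh b • v := by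
      module
    rw [this, smul_smul, div_mul_cancel₀ _ hs]

theorem hlog_self (x : Hyp d) : hlog x x = 0 := by
  apply Subtype.ext
  simp [hlog, hdist_self]

/-- Polar coordinates of `y` around `x`. The direction is a unit vector unless `y = x`. -/
theorem exists_polar (x y : Hyp d) : ∃ v : Vec d, lor x.coords v = 0 ∧ lor v v ≤ 1 ∧
    (0 < hdist x y → lor v v = 1) ∧
    y.coords = Real.cosh (hdist x y) • x.coords + Real.sinh (hdist x y) • v ∧
    (hlog x y : Vec d) = hdist x y • v := by
  rcases (hdist_nonneg x y).eq_or_lt with h | h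
  · have hxy := eq_of_hdist_eq_zero h.symm
    -- For `d = 0` there is no unit tangent vector, hence the direction `0`; the Cauchy-Schwarz
    -- estimates need only `⟨v, v⟩ ≤ 1`.
    refine ⟨0, lor_zero_right _, by rw [lor_zero_right]; exact zero_le_one, fun h' => ?_, ?_, ?_⟩
    · exact absurd h h'.ne
    · rw [← h]; simp [hxy]
    · subst hxy
      rw [hlog_self]; simp
  · have hs : Real.sinh (hdist x y) ≠ 0 := (Real.sinh_pos_iff.2 h).ne'
    set D := hdist x y with hD
    have hl := lor_eq_neg_cosh_hdist x y
    rw [← hD] at hl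
    set v : Vec d := (1 / Real.sinh D) • (y.coords - Real.cosh D • x.coords) with hv
    have hxv : lor x.coords v = 0 := by
      rw [hv, lor_smul_right, lor_sub_right, lor_smul_right, x.lor_self, hl]; ring
    have hvv : lor v v = 1 := by
      simp only [hv, lor_smul_right, lor_smul_left, lor_sub_left, lor_sub_right, x.lor_self,
        y.lor_self, lor_comm y.coords, hl]
      have := Real.cosh_sq D
      field_simp
      linear_combination this
    have hy : y.coords = Real.cosh D • x.coords + Real.sinh D • v := by
      rw [hv, smul_smul, mul_one_div_cancel hs, one_smul]; abel
    exact ⟨v, hxv, hvv.le, fun _ => hvv, hy, hlog_of_polar h.le hxv hy⟩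

/-- The norm of the logarithm bounds the inner product with vectors of norm at most one. -/
theorem abs_tinner_hlog_le {x : Hyp d} (y : Hyp d) {g : Tan x}
    (hg : lor (g : Vec d) (g : Vec d) ≤ 1) : |tinner g (hlog x y)| ≤ hdist x y := by
  obtain ⟨v, hv, hv1, -, -, hlog⟩ := exists_polar x y
  rw [tinner, hlog, lor_smul_right, abs_mul, abs_of_nonneg (hdist_nonneg x y)]
  exact mul_le_of_le_one_right (hdist_nonneg x y) (abs_lor_le_one x g.2 hv hg hv1)

theorem hexp_coords_of_polar {x : Hyp d} {v : Vec d} {b : ℝ} (hb : 0 ≤ b) {u : Tan x}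
    (hv1 : 0 < b → lor v v = 1) (hu : (u : Vec d) = b • v) :
    (hexp x u).coords = Real.cosh b • x.coords + Real.sinh b • v := by
  have hn : tnorm u = b := by
    rw [tnorm, tinner, hu, lor_smul_left, lor_smul_right]
    rcases hb.eq_or_lt with h | h
    · simp [← h]
    · rw [hv1 h, mul_one, Real.sqrt_mul_self hb]
  simp only [hexp, expVec, hn, hu]
  rcases hb.eq_or_lt with h | h
  · simp [← h]
  · rw [smul_smul, div_mul_cancel₀ _ h.ne']

theorem hexp_hlog (x y : Hyp d) : hexp x (hlog x y) = y := by
  obtain ⟨v, hv, -, hv1, hy, hl⟩ := exists_polar x y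
  apply Hyp.ext
  rw [hexp_coords_of_polar (hdist_nonneg x y) hv1 hl, hy]

/-- At an intermediate point `z` of a geodesic the logarithms of the end points balance. -/
theorem hlog_balance (x y : Hyp d) {t : ℝ} (ht : t ∈ Set.Icc (0 : ℝ) 1) :
    (1 - t) • (hlog (hexp x (t • hlog x y)) x : Vec d)
      + t • (hlog (hexp x (t • hlog x y)) y : Vec d) = 0 := by
  obtain ⟨v, hv, -, hv1, hy, hl⟩ := exists_polar x y
  set D := hdist x y
  have hD : 0 ≤ D := hdist_nonneg x y
  obtain ⟨ht0, ht1⟩ := ht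
  set z := hexp x (t • hlog x y)
  have hz : z.coords = Real.cosh (t * D) • x.coords + Real.sinh (t * D) • v := by
    refine hexp_coords_of_polar (mul_nonneg ht0 hD) (fun h => hv1 ?_) ?_
    · rcases hD.eq_or_lt with h' | h'
      · rw [← h', mul_zero] at h; exact absurd h (lt_irrefl _)
      · exact h'
    · simp only [Submodule.coe_smul, hl, smul_smul]
  rcases hD.eq_or_lt with h0 | hpos
  · have hyx : y = x := (eq_of_hdist_eq_zero h0.symm).symm
    have hzx : z = x := by
      apply Hyp.ext; rw [hz, ← h0]; simp
    rw [hyx, hzx, hlog_self]; simp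
  · have hvv := hv1 hpos
    -- The unit velocity at `z` of the geodesic from `x` to `y`, on which `x` and `y` sit at times
    -- `-tD` and `(1 - t)D`.
    set τ : Vec d := Real.sinh (t * D) • x.coords + Real.cosh (t * D) • v with hτ
    have hc := Real.cosh_sq (t * D)
    have hzτ : lor z.coords τ = 0 := by
      simp only [hz, hτ, lor_add_left, lor_add_right, lor_smul_left, lor_smul_right, x.lor_self,
        hv, hvv, lor_comm v x.coords]
      ring
    have hx' : x.coords = Real.cosh (t * D) • z.coords + Real.sinh (t * D) • (-τ) := by
      rw [hz, hτ]
      match_scalars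
      · linear_combination -hc
      · ring
    have hy' : y.coords = Real.cosh ((1 - t) * D) • z.coords + Real.sinh ((1 - t) * D) • τ := by
      have e : D = t * D + (1 - t) * D := by ring
      rw [hy, hz, hτ]
      nth_rewrite 1 2 [e]
      rw [Real.cosh_add, Real.sinh_add]
      module
    rw [hlog_of_polar (mul_nonneg ht0 hD) (by rw [lor_neg_right, hzτ, neg_zero]) hx',
      hlog_of_polar (mul_nonneg (by linarith) hD) hzτ hy']
    module

/-! ### Convexity and Lipschitz bounds from subgradients. -/

theorem tinner_smul_left {x : Hyp d} (c : ℝ) (u v : Tan x) :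
    tinner (c • u) v = c * tinner u v := lor_smul_left _ _ _

theorem tinner_add_left {x : Hyp d} (u v w : Tan x) :
    tinner (u + v) w = tinner u w + tinner v w := lor_add_left _ _ _

theorem tinner_zero_left {x : Hyp d} (v : Tan x) : tinner 0 v = 0 := lor_zero_left _

/-- The subgradient inequalities at the intermediate point towards both ends are averaged;
`hlog_balance` cancels the linear terms. -/
theorem GConvex.of_subdiff_nonempty {f : Hyp d → ℝ} (h : ∀ x, (subdiff f x).Nonempty) :
    GConvex f := by
  intro x y t ht
  have hb := hlog_balance x y ht
  set z := hexp x (t • hlog x y)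
  obtain ⟨g, hg⟩ := h z
  have h1 := hg x
  have h2 := hg y
  have h3 : (1 - t) * tinner g (hlog z x) + t * tinner g (hlog z y) = 0 := by
    have := congrArg (lor (g : Vec d)) hb
    rwa [lor_add_right, lor_smul_right, lor_smul_right, lor_zero_right] at this
  obtain ⟨ht0, ht1⟩ := ht
  nlinarith [mul_le_mul_of_nonneg_left h1 (sub_nonneg.2 ht1), mul_le_mul_of_nonneg_left h2 ht0]

theorem GLipschitz.of_subdiff {f : Hyp d → ℝ} {M : ℝ}
    (h : ∀ x, ∃ g ∈ subdiff f x, ∀ y, |tinner g (hlog x y)| ≤ M * hdist x y) :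
    GLipschitz M f := by
  have key : ∀ x y, f x - f y ≤ M * hdist x y := by
    intro x y
    obtain ⟨g, hg, hM⟩ := h x
    have h1 := hg y
    have h2 := (abs_le.1 (hM y)).1
    linarith
  intro x y
  rw [abs_le]
  have h1 := key y x
  rw [hdist_comm] at h1
  exact ⟨by linarith, key x y⟩

/-! ### The distance to a point -/

/-- If `p = cosh a x + sinh a w`, then `-w` is a subgradient at `x` of the distance to `p`. -/
theorem mem_subdiff_hdist {x p : Hyp d} {w : Vec d} (hw : lor x.coords w = 0) (hw1 : lor w w ≤ 1)
    (hp : p.coords = Real.cosh (hdist x p) • x.coords + Real.sinh (hdist x p) • w) {g : Tan x}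
    (hg : (g : Vec d) = -w) : g ∈ subdiff (fun y => hdist y p) x := by
  intro y
  obtain ⟨v, hv, hv1, -, hy, hl⟩ := exists_polar x y
  have hc := abs_lor_le_one x hw hv hw1 hv1
  rw [tinner, hl, hg, lor_smul_right, lor_neg_left]
  apply le_hdist_of_cosh_le
  -- The right side of this bound is `-⟨y, p⟩` by the law of cosines for the triangle `x`, `y`, `p`.
  have := cosh_sub_mul_le hc (hdist x p) (hdist x y)
  rw [show hdist x p + hdist x y * -lor w v = hdist x p - hdist x y * lor w v by ring]
  refine this.trans (le_of_eq ?_)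
  rw [hy]
  set b := hdist x y
  rw [hp]
  simp only [lor_add_left, lor_add_right, lor_smul_left, lor_smul_right, x.lor_self, hv, hw,
    lor_comm v x.coords, lor_comm v w]
  ring

theorem exists_mem_subdiff_hdist (x p : Hyp d) :
    ∃ g ∈ subdiff (fun y => hdist y p) x, lor (g : Vec d) (g : Vec d) ≤ 1 := by
  obtain ⟨w, hw, hw1, -, hp, -⟩ := exists_polar x p
  have hw' : lor x.coords (-w) = 0 := by rw [lor_neg_right, hw, neg_zero]
  exact ⟨⟨-w, hw'⟩, mem_subdiff_hdist hw hw1 hp rfl, by simpa [lor_neg_left, lor_neg_right]⟩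

/-! ### The distance to a half-space -/

/-- The half-space bounded by the hyperplane with unit normal `n`. -/
def halfSpaceOf (n : Vec d) : Set (Hyp d) := {z | 0 ≤ lor n z.coords}

/-- The projection of a normal vector to a tangent space. -/
theorem exists_unit_tangent_of_unit {n : Vec d} (hn : lor n n = 1) (x : Hyp d) :
    ∃ w : Vec d, ∃ a : ℝ, lor x.coords w = 0 ∧ lor w w = 1 ∧
      n = Real.sinh a • x.coords - Real.cosh a • w := by
  -- The signed distance of `x` from the half-space, positive outside; `w` points away from the
  -- half-space.
  set a := Real.arsinh (-lor n x.coords) with ha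
  have hs : lor n x.coords = -Real.sinh a := by rw [ha, Real.sinh_arsinh, neg_neg]
  have hc := (Real.cosh_pos a).ne'
  have hsq := Real.cosh_sq a
  refine ⟨(1 / Real.cosh a) • (Real.sinh a • x.coords - n), a, ?_, ?_, ?_⟩
  · simp only [lor_smul_right, lor_sub_right, x.lor_self, lor_comm x.coords n, hs]; ring
  · simp only [lor_smul_right, lor_smul_left, lor_sub_right, lor_sub_left, x.lor_self,
      lor_comm x.coords n, hs, hn]
    field_simp
    linear_combination -hsq
  · rw [smul_smul, mul_one_div_cancel hc, one_smul]; abel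

theorem hdistSet_nonneg (x : Hyp d) (S : Set (Hyp d)) : 0 ≤ hdistSet x S := by
  apply Real.sInf_nonneg
  rintro _ ⟨z, -, rfl⟩
  exact hdist_nonneg x z

theorem hdistSet_le {x z : Hyp d} {S : Set (Hyp d)} (hz : z ∈ S) : hdistSet x S ≤ hdist x z :=
  csInf_le ⟨0, by rintro _ ⟨z, -, rfl⟩; exact hdist_nonneg x z⟩ ⟨z, hz, rfl⟩

theorem hdistSet_eq_zero {x : Hyp d} {S : Set (Hyp d)} (hx : x ∈ S) : hdistSet x S = 0 :=
  le_antisymm ((hdistSet_le hx).trans (hdist_self x).le) (hdistSet_nonneg x S)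

/-- The foot of the perpendicular from a point outside the half-space. -/
theorem exists_mem_halfSpaceOf_hdist {n : Vec d} (hn : lor n n = 1) (x : Hyp d)
    (hx : lor n x.coords ≤ 0) :
    ∃ z ∈ halfSpaceOf n, hdist x z = Real.arsinh (-lor n x.coords) := by
  obtain ⟨w, a, hw, hw1, hna⟩ := exists_unit_tangent_of_unit hn x
  have hwx : lor w x.coords = 0 := by rw [lor_comm, hw]
  have hnx : lor n x.coords = -Real.sinh a := by
    rw [hna, lor_sub_left, lor_smul_left, lor_smul_left, x.lor_self, hwx]; ring
  have ha : 0 ≤ a := by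
    rw [← Real.sinh_nonneg_iff]; linarith
  have hw' : lor x.coords (-w) = 0 := by rw [lor_neg_right, hw, neg_zero]
  have hz := hexp_coords_of_polar (x := x) (v := -w) (u := a • ⟨-w, hw'⟩) ha
    (fun _ => by simpa [lor_neg_left, lor_neg_right]) rfl
  refine ⟨hexp x (a • ⟨-w, hw'⟩), ?_, ?_⟩
  · simp only [halfSpaceOf, Set.mem_ofPred_eq, hz, hna, lor_add_right, lor_sub_left, lor_smul_left,
      lor_smul_right, lor_neg_right, x.lor_self, hw, hwx, hw1]
    apply le_of_eq; ring
  · rw [hdist_of_polar ha hw' hz, hnx, neg_neg, Real.arsinh_sinh]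

theorem halfSpaceOf_nonempty {n : Vec d} (hn : lor n n = 1) (x : Hyp d) :
    (halfSpaceOf n).Nonempty := by
  rcases le_total 0 (lor n x.coords) with h | h
  · exact ⟨x, h⟩
  · obtain ⟨z, hz, -⟩ := exists_mem_halfSpaceOf_hdist hn x h
    exact ⟨z, hz⟩

/-- The signed distance is a lower bound on both sides of the hyperplane, so subgradient
inequalities can be checked on it without asking where the second point lies. -/
theorem arsinh_le_hdistSet {n : Vec d} (hn : lor n n = 1) (x : Hyp d) :
    Real.arsinh (-lor n x.coords) ≤ hdistSet x (halfSpaceOf n) := by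
  apply le_csInf ((halfSpaceOf_nonempty hn x).image _)
  rintro _ ⟨z, hz, rfl⟩
  obtain ⟨w, a, hw, hw1, hna⟩ := exists_unit_tangent_of_unit hn x
  obtain ⟨v, hv, hv1, -, hy, -⟩ := exists_polar x z
  have hwx : lor w x.coords = 0 := by rw [lor_comm, hw]
  have hnx : lor n x.coords = -Real.sinh a := by
    rw [hna, lor_sub_left, lor_smul_left, lor_smul_left, x.lor_self, hwx]; ring
  rw [hnx, neg_neg, Real.arsinh_sinh]
  have hz' : 0 ≤ lor n z.coords := hz
  set b := hdist x z with hb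
  have hb0 : 0 ≤ b := hdist_nonneg x z
  rw [hy, hna] at hz'
  simp only [lor_add_right, lor_sub_left, lor_smul_left, lor_smul_right, x.lor_self, hv, hwx]
    at hz'
  have hc := (abs_le.1 (abs_lor_le_one x hw hv hw1.le hv1)).1
  have hsb := Real.sinh_nonneg_iff.2 hb0
  have hca := Real.cosh_pos a
  have h1 : Real.sinh (a - b) ≤ 0 := by
    rw [Real.sinh_sub]
    nlinarith [mul_le_mul_of_nonneg_left hc (mul_nonneg hca.le hsb)]
  linarith [Real.sinh_nonpos_iff.1 h1]

theorem hdistSet_halfSpaceOf {n : Vec d} (hn : lor n n = 1) {x : Hyp d}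
    (hx : lor n x.coords ≤ 0) :
    hdistSet x (halfSpaceOf n) = Real.arsinh (-lor n x.coords) := by
  obtain ⟨z, hz, hd⟩ := exists_mem_halfSpaceOf_hdist hn x hx
  exact le_antisymm (hd ▸ hdistSet_le hz) (arsinh_le_hdistSet hn x)

/-- At a point of the bounding hyperplane, the vectors `-l n` with `l ∈ [0, 1]` are subgradients of
the distance to the half-space with unit normal `n`. -/
theorem mem_subdiff_hdistSet_of_boundary {n : Vec d} (hn : lor n n = 1) {x : Hyp d}
    (hx : lor n x.coords = 0) {l : ℝ} (hl0 : 0 ≤ l) (hl1 : l ≤ 1) {g : Tan x}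
    (hg : (g : Vec d) = -(l • n)) :
    g ∈ subdiff (fun y => hdistSet y (halfSpaceOf n)) x := by
  intro y
  obtain ⟨v, hv, hv1, -, hy, hlog⟩ := exists_polar x y
  have hxn : lor x.coords n = 0 := by rw [lor_comm, hx]
  have hc := abs_le.1 (abs_lor_le_one x hxn hv hn.le hv1)
  have h0 : hdistSet x (halfSpaceOf n) = 0 := hdistSet_eq_zero hx.ge
  have hb0 := hdist_nonneg x y
  simp only [h0, tinner, hlog, hg, lor_smul_right, lor_neg_left, lor_smul_left, zero_add]
  rcases le_total 0 (lor n v) with h | h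
  · refine le_trans ?_ (hdistSet_nonneg y _)
    have := mul_nonneg hb0 (mul_nonneg hl0 h)
    linarith
  -- Here the geodesic leaves the half-space, and the signed distance of `y` is `arsinh (-⟨n, v⟩
  -- sinh b)` with `b = dist(x, y)`.
  · refine le_trans ?_ (arsinh_le_hdistSet hn y)
    rw [hy, lor_add_right, lor_smul_right, lor_smul_right, hx, ← Real.sinh_le_sinh,
      Real.sinh_arsinh]
    have h1 := sinh_mul_le (c := -lor n v) (by linarith) (by linarith [hc.1]) hb0
    refine le_trans ?_ (h1.trans (le_of_eq (by ring)))
    rw [Real.sinh_le_sinh]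
    have := mul_nonneg (mul_nonneg hb0 (neg_nonneg.2 h)) (sub_nonneg.2 hl1)
    linarith

/-- Inside the half-space `0` serves; outside, the unit vector pointing away from the foot of the
perpendicular, by `sinh_add_mul_le`. Where the linear bound is negative, nonnegativity of the
distance suffices. -/
theorem exists_mem_subdiff_hdistSet {n : Vec d} (hn : lor n n = 1) (x : Hyp d) :
    ∃ g ∈ subdiff (fun y => hdistSet y (halfSpaceOf n)) x, lor (g : Vec d) (g : Vec d) ≤ 1 := by
  rcases le_total 0 (lor n x.coords) with hx | hx
  · refine ⟨0, fun y => ?_, by simp [lor_zero_right]⟩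
    have h0 : hdistSet x (halfSpaceOf n) = 0 := hdistSet_eq_zero hx
    simp only [h0, tinner_zero_left, add_zero]
    exact hdistSet_nonneg y _
  · obtain ⟨w, a, hw, hw1, hna⟩ := exists_unit_tangent_of_unit hn x
    have hwx : lor w x.coords = 0 := by rw [lor_comm, hw]
    have hnx : lor n x.coords = -Real.sinh a := by
      rw [hna, lor_sub_left, lor_smul_left, lor_smul_left, x.lor_self, hwx]; ring
    have ha : 0 ≤ a := by
      rw [← Real.sinh_nonneg_iff]; linarith
    refine ⟨⟨w, hw⟩, fun y => ?_, hw1.le⟩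
    obtain ⟨v, hv, hv1, -, hy, hlog⟩ := exists_polar x y
    have hc := abs_lor_le_one x hw hv hw1.le hv1
    have hb0 := hdist_nonneg x y
    simp only [hdistSet_halfSpaceOf hn hx, hnx, neg_neg, Real.arsinh_sinh, tinner, hlog,
      lor_smul_right]
    rcases le_total 0 (a + hdist x y * lor w v) with h | h
    · refine le_trans ?_ (arsinh_le_hdistSet hn y)
      rw [← Real.sinh_le_sinh, Real.sinh_arsinh]
      refine (sinh_add_mul_le ha hb0 hc h).trans (le_of_eq ?_)
      rw [hy]
      set b := hdist x y
      rw [hna]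
      simp only [lor_add_right, lor_sub_left, lor_smul_left, lor_smul_right, x.lor_self, hv, hwx]
      ring
    · exact h.trans (hdistSet_nonneg y _)

variable {r θ : ℝ} {x₀ : Hyp d} {e : Fin d → Tan x₀}

/-! ### The frame and the points `y_k` -/

theorem frameVec_of_lt {y : Hyp d} (E : Fin d → Tan y) {k : ℕ} (h : k < d) :
    frameVec E k = E ⟨k, h⟩ := dif_pos h

theorem lor_frameVec (he : ∀ i j, tinner (e i) (e j) = if i = j then 1 else 0) {i j : ℕ}
    (hi : i < d) (hj : j < d) :
    lor (frameVec e i : Vec d) (frameVec e j : Vec d) = if i = j then 1 else 0 := by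
  rw [frameVec_of_lt e hi, frameVec_of_lt e hj]
  have := he ⟨i, hi⟩ ⟨j, hj⟩
  rw [tinner] at this
  simpa [Fin.ext_iff] using this

/-- Parallel transport does not move the frame vectors that are still to be used. -/
theorem stage_frame (he : ∀ i j, tinner (e i) (e j) = if i = j then 1 else 0) (k : ℕ)
    (i : Fin d) (hi : k ≤ i) : ((stage r θ x₀ e k).2 i : Vec d) = e i := by
  induction k generalizing i with
  | zero => rfl
  | succ k ih =>
    have hk : k < d := lt_of_lt_of_le (Nat.lt_of_succ_le hi) i.2.le
    have h1 := ih i (by omega)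
    have h2 := ih ⟨k, hk⟩ le_rfl
    have h3 : lor (stage r θ x₀ e k).1.coords (e i : Vec d) = 0 := by
      rw [← h1]; exact ((stage r θ x₀ e k).2 i).2
    have h4 : lor (e ⟨k, hk⟩ : Vec d) (e i : Vec d) = 0 := by
      have := he ⟨k, hk⟩ i
      rw [if_neg (by rw [Fin.ext_iff]; simp only; omega)] at this
      exact this
    -- The correction in the transport is a multiple of `⟨y_{k+1}, e i⟩`, and `y_{k+1}` is a
    -- combination of `y_k` and the `k`-th frame vector, both orthogonal to `e i`.
    simp only [stage, transport, hexp, expVec, frameVec_of_lt _ hk, Submodule.coe_smul, h1, h2,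
      lor_add_left, lor_smul_left, h3, h4]
    simp

theorem yDir_coords (he : ∀ i j, tinner (e i) (e j) = if i = j then 1 else 0) {k : ℕ}
    (hk : k < d) : (yDir r θ x₀ e k : Vec d) = frameVec e k := by
  rw [frameVec_of_lt e hk, ← stage_frame (r := r) (θ := θ) he k ⟨k, hk⟩ le_rfl]
  exact congrArg Subtype.val (frameVec_of_lt (stage r θ x₀ e k).2 hk)

theorem lor_yPt_frameVec_of_le (he : ∀ i j, tinner (e i) (e j) = if i = j then 1 else 0) {k j : ℕ}
    (hkj : k ≤ j) (hj : j < d) : lor (yPt r θ x₀ e k).coords (frameVec e j : Vec d) = 0 := by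
  have h := stage_frame (r := r) (θ := θ) he k ⟨j, hj⟩ hkj
  rw [frameVec_of_lt _ hj, ← h]
  exact ((stage r θ x₀ e k).2 ⟨j, hj⟩).2

theorem cos_mul_tanh_mem (hθ : θ ∈ Set.Ioo 0 (Real.pi / 2)) {ρ : ℝ} (hρ : 0 < ρ) :
    Real.cos θ * Real.tanh ρ ∈ Set.Ioo (0 : ℝ) 1 := by
  have hc : 0 < Real.cos θ := Real.cos_pos_of_mem_Ioo ⟨by linarith [hθ.1, Real.pi_pos], hθ.2⟩
  have h1 := Real.cos_le_one θ
  have h2 : 0 < Real.tanh ρ := by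
    rw [Real.tanh_eq_sinh_div_cosh]; exact div_pos (Real.sinh_pos_iff.2 hρ) (Real.cosh_pos ρ)
  have h3 := Real.tanh_lt_one ρ
  exact ⟨mul_pos hc h2, by nlinarith⟩

theorem sin_pos_of_mem (hθ : θ ∈ Set.Ioo 0 (Real.pi / 2)) : 0 < Real.sin θ :=
  Real.sin_pos_of_pos_of_lt_pi hθ.1 (by linarith [hθ.2, Real.pi_pos])

theorem cos_pos_of_mem (hθ : θ ∈ Set.Ioo 0 (Real.pi / 2)) : 0 < Real.cos θ :=
  Real.cos_pos_of_mem_Ioo ⟨by linarith [hθ.1, Real.pi_pos], hθ.2⟩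

theorem stepLen_pos (hr : 0 < r) (hθ : θ ∈ Set.Ioo 0 (Real.pi / 2)) (k : ℕ) :
    0 < stepLen r θ k :=
  Real.artanh_pos (cos_mul_tanh_mem hθ (radius_pos hr (sin_pos_of_mem hθ) k))

theorem cosh_radius_succ (hr : 0 < r) (hθ : θ ∈ Set.Ioo 0 (Real.pi / 2)) (k : ℕ) :
    Real.cosh (radius r θ (k + 1)) =
      Real.cosh (radius r θ k) * √(1 - (Real.cos θ * Real.tanh (radius r θ k)) ^ 2) := by
  have ht := cos_mul_tanh_mem hθ (radius_pos hr (sin_pos_of_mem hθ) k)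
  have hc := Real.cosh_pos (radius r θ k)
  rw [← sq_eq_sq₀ (Real.cosh_pos _).le (by positivity), mul_pow, Real.sq_sqrt (by
    nlinarith [ht.1, ht.2]), Real.cosh_sq (radius r θ (k + 1)), radius, Real.sinh_arsinh,
    Real.tanh_eq_sinh_div_cosh]
  have h1 := Real.cosh_sq (radius r θ k)
  have h2 := Real.sin_sq_add_cos_sq θ
  field_simp
  linear_combination (Real.sinh (radius r θ k)) ^ 2 * h2 - h1

/-- Hyperbolic Pythagoras in the right triangle with hypotenuse `r_k`, legs `Δ_k` and `r_{k+1}`, and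
angle `θ` between `r_k` and `Δ_k`. -/
theorem cosh_stepLen_mul (hr : 0 < r) (hθ : θ ∈ Set.Ioo 0 (Real.pi / 2)) (k : ℕ) :
    Real.cosh (stepLen r θ k) * Real.cosh (radius r θ (k + 1)) = Real.cosh (radius r θ k) := by
  have ht := cos_mul_tanh_mem hθ (radius_pos hr (sin_pos_of_mem hθ) k)
  have hpos : 0 < √(1 - (Real.cos θ * Real.tanh (radius r θ k)) ^ 2) :=
    Real.sqrt_pos.2 (by nlinarith [ht.1, ht.2])
  rw [cosh_radius_succ hr hθ, stepLen, Real.cosh_artanh ⟨by linarith [ht.1], ht.2⟩,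
    one_div, inv_mul_eq_div, mul_div_assoc, div_self hpos.ne', mul_one]

theorem sinh_stepLen_mul (hr : 0 < r) (hθ : θ ∈ Set.Ioo 0 (Real.pi / 2)) (k : ℕ) :
    Real.sinh (stepLen r θ k) * Real.cosh (radius r θ (k + 1)) =
      Real.cos θ * Real.sinh (radius r θ k) := by
  have ht := cos_mul_tanh_mem hθ (radius_pos hr (sin_pos_of_mem hθ) k)
  have hpos : 0 < √(1 - (Real.cos θ * Real.tanh (radius r θ k)) ^ 2) :=
    Real.sqrt_pos.2 (by nlinarith [ht.1, ht.2])
  have hc := Real.cosh_pos (radius r θ k)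
  rw [cosh_radius_succ hr hθ, stepLen, Real.sinh_artanh ⟨by linarith [ht.1], ht.2⟩]
  rw [div_mul_eq_mul_div, div_eq_iff hpos.ne', Real.tanh_eq_sinh_div_cosh]
  field_simp

theorem yPt_succ (hr : 0 < r) (hθ : θ ∈ Set.Ioo 0 (Real.pi / 2))
    (he : ∀ i j, tinner (e i) (e j) = if i = j then 1 else 0) {k : ℕ} (hk : k < d) :
    (yPt r θ x₀ e (k + 1)).coords = Real.cosh (stepLen r θ k) • (yPt r θ x₀ e k).coords +
      Real.sinh (stepLen r θ k) • (frameVec e k : Vec d) := by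
  refine hexp_coords_of_polar (x := yPt r θ x₀ e k)
    (u := stepLen r θ k • yDir r θ x₀ e k) (stepLen_pos hr hθ k).le (fun _ => ?_) ?_
  · rw [lor_frameVec he hk hk, if_pos rfl]
  · rw [Submodule.coe_smul, yDir_coords he hk]

/-- A step multiplies the pairing by `cosh Δ_k = cosh r_k / cosh r_{k+1}`, so the factor `cosh r_k`
makes it independent of `k`. The value is the one that points of `S_k` have. -/
theorem cosh_mul_lor_yPt_frameVec (hr : 0 < r) (hθ : θ ∈ Set.Ioo 0 (Real.pi / 2))
    (he : ∀ i j, tinner (e i) (e j) = if i = j then 1 else 0) {k j : ℕ} (hk : k ≤ d)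
    (hj : j < k) : Real.cosh (radius r θ k) * lor (yPt r θ x₀ e k).coords (frameVec e j : Vec d) =
      Real.cos θ * Real.sinh (radius r θ j) := by
  induction k with
  | zero => omega
  | succ k ih =>
    have h1 := cosh_stepLen_mul hr hθ k
    have h2 := sinh_stepLen_mul hr hθ k
    rw [yPt_succ hr hθ he (by omega), lor_add_left, lor_smul_left, lor_smul_left,
      lor_frameVec he (by omega) (by omega)]
    rcases Nat.lt_succ_iff_lt_or_eq.1 hj with h | rfl
    · rw [← ih (by omega) h, if_neg (by omega), ← h1]; ring
    · rw [lor_yPt_frameVec_of_le he le_rfl (by omega), if_pos rfl, ← h2]; ring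

theorem cosh_mul_lor_yPt_yPt (hr : 0 < r) (hθ : θ ∈ Set.Ioo 0 (Real.pi / 2))
    (he : ∀ i j, tinner (e i) (e j) = if i = j then 1 else 0) {k j : ℕ} (hk : k ≤ d)
    (hj : j ≤ k) : Real.cosh (radius r θ k) *
      lor (yPt r θ x₀ e k).coords (yPt r θ x₀ e j).coords = -Real.cosh (radius r θ j) := by
  induction k with
  | zero =>
    obtain rfl : j = 0 := by omega
    rw [(yPt r θ x₀ e 0).lor_self]; ring
  | succ k ih =>
    rcases hj.lt_or_eq with h | rfl
    · have h1 := cosh_stepLen_mul hr hθ k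
      rw [yPt_succ hr hθ he (by omega), lor_add_left, lor_smul_left, lor_smul_left,
        lor_comm (frameVec e k : Vec d), lor_yPt_frameVec_of_le he (by omega) (by omega),
        ← ih (by omega) (by omega), ← h1]
      ring
    · rw [(yPt r θ x₀ e (k + 1)).lor_self]; ring

/-! ### The spheres `S_k` -/

theorem hdist_yPt_of_lor (hr : 0 < r) (hθ : θ ∈ Set.Ioo 0 (Real.pi / 2))
    (he : ∀ i j, tinner (e i) (e j) = if i = j then 1 else 0) {x : Hyp d} {k : ℕ} (hk : k ≤ d)
    (h0 : hdist x₀ x = r)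
    (h : ∀ j < k, lor (frameVec e j : Vec d) x.coords = Real.cos θ * Real.sinh (radius r θ j)) :
    hdist (yPt r θ x₀ e k) x = radius r θ k := by
  induction k with
  | zero => exact h0
  | succ k ih =>
    have h1 := ih (by omega) fun j hj => h j (by omega)
    have hl := lor_eq_neg_cosh_hdist (yPt r θ x₀ e k) x
    have hΔ := Real.cosh_sq (stepLen r θ k)
    refine hdist_eq_of_cosh (radius_pos hr (sin_pos_of_mem hθ) _).le ?_
    rw [yPt_succ hr hθ he (by omega), lor_add_left, lor_smul_left, lor_smul_left, hl, h1,
      h k (by omega), ← sinh_stepLen_mul hr hθ k, ← cosh_stepLen_mul hr hθ k]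
    linear_combination (-Real.cosh (radius r θ (k + 1))) * hΔ

theorem tangle_yDir_eq_iff (hθ : θ ∈ Set.Ioo 0 (Real.pi / 2))
    (he : ∀ i j, tinner (e i) (e j) = if i = j then 1 else 0) {x : Hyp d} {k : ℕ} (hk : k < d)
    (hx : 0 < hdist (yPt r θ x₀ e k) x) :
    tangle (yDir r θ x₀ e k) (hlog (yPt r θ x₀ e k) x) = θ ↔
      lor (frameVec e k : Vec d) x.coords =
        Real.cos θ * Real.sinh (hdist (yPt r θ x₀ e k) x) := by
  obtain ⟨v, hv, hv1, hvv, hy, hl⟩ := exists_polar (yPt r θ x₀ e k) x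
  replace hvv := hvv hx
  have hE := lor_yPt_frameVec_of_le (r := r) (θ := θ) he le_rfl hk
  have hEE : lor (frameVec e k : Vec d) (frameVec e k : Vec d) = 1 := by
    rw [lor_frameVec he hk hk, if_pos rfl]
  have hEy : lor (frameVec e k : Vec d) (yPt r θ x₀ e k).coords = 0 := by rw [lor_comm, hE]
  set D := hdist (yPt r θ x₀ e k) x
  have hn1 : tnorm (yDir r θ x₀ e k) = 1 := by
    rw [tnorm, tinner, yDir_coords he hk, hEE, Real.sqrt_one]
  have hn2 : tnorm (hlog (yPt r θ x₀ e k) x) = D := by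
    rw [tnorm, tinner, hl, lor_smul_left, lor_smul_right, hvv, mul_one,
      Real.sqrt_mul_self hx.le]
  have hc := abs_le.1 (abs_lor_le_one _ hE hv hEE.le hv1)
  have ht : tangle (yDir r θ x₀ e k) (hlog (yPt r θ x₀ e k) x) =
      Real.arccos (lor (frameVec e k : Vec d) v) := by
    rw [tangle, hn1, hn2, tinner, yDir_coords he hk, hl, lor_smul_right, one_mul,
      mul_div_cancel_left₀ _ hx.ne']
  rw [ht, hy, lor_add_right, lor_smul_right, lor_smul_right, hEy, mul_zero, zero_add,
    mul_comm (Real.cos θ), mul_right_inj' (Real.sinh_pos_iff.2 hx).ne']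
  constructor
  · intro h
    rw [← Real.cos_arccos hc.1 hc.2, h]
  · intro h
    rw [h, Real.arccos_cos hθ.1.le (by linarith [hθ.2, Real.pi_pos])]

/-- The linear conditions up to stage `k` force `dist(y_k, x) = r_k`; the angle condition at `y_k`
then becomes the next linear one. -/
theorem mem_sphereSet_iff (hr : 0 < r) (hθ : θ ∈ Set.Ioo 0 (Real.pi / 2))
    (he : ∀ i j, tinner (e i) (e j) = if i = j then 1 else 0) {x : Hyp d} {k : ℕ} (hk : k ≤ d) :
    x ∈ sphereSet r θ x₀ e k ↔ hdist x₀ x = r ∧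
      ∀ j < k, lor (frameVec e j : Vec d) x.coords = Real.cos θ * Real.sinh (radius r θ j) := by
  induction k with
  | zero => simp [sphereSet]
  | succ k ih =>
    simp only [sphereSet, Set.mem_ofPred_eq]
    rw [ih (by omega), and_assoc]
    refine and_congr_right fun h0 => ?_
    rw [Nat.forall_lt_succ_right]
    refine and_congr_right fun h => ?_
    have hd := hdist_yPt_of_lor hr hθ he (by omega) h0 h
    rw [tangle_yDir_eq_iff hθ he (by omega)
      (by rw [hd]; exact radius_pos hr (sin_pos_of_mem hθ) k), hd]

/-- The witness lies at distance `r_k` from `y_k` along the next frame vector. That vector is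
orthogonal to `y₀` and to the earlier frame vectors, so only the part `cosh r_k y_k` of the witness
counts. The bound `k < d` provides the vector. -/
theorem sphereSet_nonempty (hr : 0 < r) (hθ : θ ∈ Set.Ioo 0 (Real.pi / 2))
    (he : ∀ i j, tinner (e i) (e j) = if i = j then 1 else 0) {k : ℕ} (hk : k < d) :
    (sphereSet r θ x₀ e k).Nonempty := by
  have hρ := radius_pos hr (sin_pos_of_mem hθ) k
  have hE := lor_yPt_frameVec_of_le (r := r) (θ := θ) he le_rfl hk
  have hp := hexp_coords_of_polar (x := yPt r θ x₀ e k) (v := (frameVec e k : Vec d))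
    (u := radius r θ k • ⟨_, hE⟩) hρ.le
    (fun _ => by rw [lor_frameVec he hk hk, if_pos rfl]) rfl
  refine ⟨hexp (yPt r θ x₀ e k) (radius r θ k • ⟨_, hE⟩),
    (mem_sphereSet_iff hr hθ he hk.le).2 ⟨hdist_eq_of_cosh hr.le ?_, fun j hj => ?_⟩⟩
  · have h1 := lor_yPt_frameVec_of_le (r := r) (θ := θ) he (Nat.zero_le k) hk
    have h2 := cosh_mul_lor_yPt_yPt (x₀ := x₀) hr hθ he hk.le (Nat.zero_le k)
    change lor (yPt r θ x₀ e 0).coords _ = _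
    rw [hp, lor_add_right, lor_smul_right, lor_smul_right, h1, lor_comm, h2]
    simp [radius]
  · rw [hp, lor_add_right, lor_smul_right, lor_smul_right, lor_frameVec he (by omega) hk,
      if_neg hj.ne, lor_comm, cosh_mul_lor_yPt_frameVec hr hθ he hk.le hj]
    ring

/-! ### The half-spaces `L_k` -/

/-- As `V` is orthogonal to `y`, `⟨V, exp_y v⟩` is a positive multiple of `⟨V, v⟩` for `v ≠ 0`. -/
theorem hexp_image_halfSpace {y : Hyp d} (V : Tan y) :
    hexp y '' {v | 0 ≤ tinner V v} = {z | 0 ≤ lor (V : Vec d) z.coords} := by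
  have hV : lor (V : Vec d) y.coords = 0 := by rw [lor_comm]; exact V.2
  ext z
  constructor
  · rintro ⟨v, hv, rfl⟩
    simp only [Set.mem_ofPred_eq, hexp, expVec, lor_add_right, lor_smul_right, hV, mul_zero,
      zero_add]
    have hn : 0 ≤ tnorm v := Real.sqrt_nonneg _
    exact mul_nonneg (div_nonneg (Real.sinh_nonneg_iff.2 hn) hn) hv
  · intro hz
    refine ⟨hlog y z, ?_, hexp_hlog y z⟩
    have hz' : 0 ≤ lor (V : Vec d) z.coords := hz
    obtain ⟨v, hv, -, -, hy, hl⟩ := exists_polar y z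
    rw [hy, lor_add_right, lor_smul_right, lor_smul_right, hV, mul_zero, zero_add] at hz'
    simp only [Set.mem_ofPred_eq, tinner, hl, lor_smul_right]
    rcases (hdist_nonneg y z).eq_or_lt with h | h
    · rw [← h, zero_mul]
    · exact mul_nonneg h.le ((mul_nonneg_iff_of_pos_left (Real.sinh_pos_iff.2 h)).1 hz')

theorem halfSpace_eq {xs : Hyp d} (k : ℕ) :
    halfSpace r θ x₀ e xs k = {z | 0 ≤ lor (normalVec r θ x₀ e xs k : Vec d) z.coords} :=
  hexp_image_halfSpace _

theorem normalVec_coords (hr : 0 < r) (hθ : θ ∈ Set.Ioo 0 (Real.pi / 2))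
    (he : ∀ i j, tinner (e i) (e j) = if i = j then 1 else 0) {xs : Hyp d} {k : ℕ} (hk : k < d)
    (hxs : xs ∈ sphereSet r θ x₀ e k) :
    (normalVec r θ x₀ e xs k : Vec d) = (1 / Real.cos θ) • (frameVec e k : Vec d) -
      (1 / Real.sinh (radius r θ k)) •
        (xs.coords - Real.cosh (radius r θ k) • (yPt r θ x₀ e k).coords) := by
  obtain ⟨h0, h⟩ := (mem_sphereSet_iff hr hθ he hk.le).1 hxs
  have hd := hdist_yPt_of_lor hr hθ he hk.le h0 h
  have hρ := radius_pos hr (sin_pos_of_mem hθ) k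
  simp only [normalVec, Submodule.coe_sub, Submodule.coe_smul, yDir_coords he hk, hlog, hd,
    smul_smul]
  congr 2
  · field_simp
  · module

/-- `x*` lies on the boundary of `L_k`: both terms of `V_k` pair with it to `sinh r_k`, the first by
the angle condition at `y_k`. -/
theorem lor_normalVec_xs (hr : 0 < r) (hθ : θ ∈ Set.Ioo 0 (Real.pi / 2))
    (he : ∀ i j, tinner (e i) (e j) = if i = j then 1 else 0) {xs : Hyp d} {k : ℕ} (hk : k < d)
    (hxs : xs ∈ sphereSet r θ x₀ e (k + 1)) :
    lor (normalVec r θ x₀ e xs k : Vec d) xs.coords = 0 := by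
  obtain ⟨h0, h⟩ := (mem_sphereSet_iff hr hθ he hk).1 hxs
  have hd := hdist_yPt_of_lor hr hθ he hk.le h0 fun j hj => h j (by omega)
  have hl := lor_eq_neg_cosh_hdist (yPt r θ x₀ e k) xs
  rw [hd] at hl
  have hs := (Real.sinh_pos_iff.2 (radius_pos hr (sin_pos_of_mem hθ) k)).ne'
  have hc := (cos_pos_of_mem hθ).ne'
  have hsq := Real.cosh_sq (radius r θ k)
  rw [normalVec_coords hr hθ he hk hxs.1, lor_sub_left, lor_smul_left, lor_smul_left, lor_sub_left,
    lor_smul_left, xs.lor_self, hl, h k (by omega)]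
  field_simp
  linear_combination -hsq

theorem lor_normalVec_self (hr : 0 < r) (hθ : θ ∈ Set.Ioo 0 (Real.pi / 2))
    (he : ∀ i j, tinner (e i) (e j) = if i = j then 1 else 0) {xs : Hyp d} {k : ℕ} (hk : k < d)
    (hxs : xs ∈ sphereSet r θ x₀ e (k + 1)) :
    lor (normalVec r θ x₀ e xs k : Vec d) (normalVec r θ x₀ e xs k : Vec d) =
      (Real.sin θ / Real.cos θ) ^ 2 := by
  obtain ⟨h0, h⟩ := (mem_sphereSet_iff hr hθ he hk).1 hxs
  have hV := lor_normalVec_xs hr hθ he hk hxs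
  have hy : lor (normalVec r θ x₀ e xs k : Vec d) (yPt r θ x₀ e k).coords = 0 := by
    rw [lor_comm]; exact (normalVec r θ x₀ e xs k).2
  have hE : lor (normalVec r θ x₀ e xs k : Vec d) (frameVec e k : Vec d) =
      1 / Real.cos θ - Real.cos θ := by
    have hs := (Real.sinh_pos_iff.2 (radius_pos hr (sin_pos_of_mem hθ) k)).ne'
    have hc := (cos_pos_of_mem hθ).ne'
    rw [normalVec_coords hr hθ he hk hxs.1, lor_sub_left, lor_smul_left, lor_smul_left,
      lor_sub_left, lor_smul_left, lor_frameVec he hk hk, if_pos rfl,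
      lor_yPt_frameVec_of_le he le_rfl hk, lor_comm xs.coords, h k (by omega)]
    field_simp
    ring
  have hc := (cos_pos_of_mem hθ).ne'
  have h2 := Real.sin_sq_add_cos_sq θ
  nth_rewrite 2 [normalVec_coords hr hθ he hk hxs.1]
  rw [lor_sub_right, lor_smul_right, lor_smul_right, lor_sub_right, lor_smul_right, hV, hy, hE]
  field_simp
  linear_combination -h2

/-- The unit normal of `L_k`. -/
noncomputable def unitNormal (r θ : ℝ) (x₀ : Hyp d) (e : Fin d → Tan x₀) (xs : Hyp d) (k : ℕ) :
    Vec d :=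
  (Real.cos θ / Real.sin θ) • (normalVec r θ x₀ e xs k : Vec d)

theorem lor_unitNormal_self (hr : 0 < r) (hθ : θ ∈ Set.Ioo 0 (Real.pi / 2))
    (he : ∀ i j, tinner (e i) (e j) = if i = j then 1 else 0) {xs : Hyp d} {k : ℕ} (hk : k < d)
    (hxs : xs ∈ sphereSet r θ x₀ e (k + 1)) :
    lor (unitNormal r θ x₀ e xs k) (unitNormal r θ x₀ e xs k) = 1 := by
  have hc := (cos_pos_of_mem hθ).ne'
  have hs := (sin_pos_of_mem hθ).ne'
  rw [unitNormal, lor_smul_left, lor_smul_right, lor_normalVec_self hr hθ he hk hxs]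
  field_simp

theorem halfSpace_eq_halfSpaceOf (hθ : θ ∈ Set.Ioo 0 (Real.pi / 2)) {xs : Hyp d} (k : ℕ) :
    halfSpace r θ x₀ e xs k = halfSpaceOf (unitNormal r θ x₀ e xs k) := by
  have hp : 0 < Real.cos θ / Real.sin θ := div_pos (cos_pos_of_mem hθ) (sin_pos_of_mem hθ)
  ext z
  rw [halfSpace_eq]
  simp only [halfSpaceOf, unitNormal, Set.mem_ofPred_eq, lor_smul_left,
    mul_nonneg_iff_of_pos_left hp]

/-! ### The span of `y₀, …, y_k` -/

theorem yPt_mem_linSpan {i k : ℕ} (h : i ≤ k) :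
    (yPt r θ x₀ e i).coords ∈ linSpan (yPts r θ x₀ e k) :=
  Submodule.subset_span (Or.inl ⟨⟨_, 0⟩, ⟨i, h, rfl⟩, rfl⟩)

theorem linSpan_le_iff {Z : Set (TBundle d)} {W : Submodule ℝ (Vec d)} :
    linSpan Z ≤ W ↔ ∀ z ∈ Z, z.1.coords ∈ W ∧ (z.2 : Vec d) ∈ W := by
  simp only [linSpan, Submodule.span_le, Set.union_subset_iff, Set.image_subset_iff]
  exact ⟨fun h z hz => ⟨h.1 hz, h.2 hz⟩, fun h => ⟨fun z hz => (h z hz).1, fun z hz => (h z hz).2⟩⟩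

theorem linSpan_yPts_mono {k l : ℕ} (h : k ≤ l) :
    linSpan (yPts r θ x₀ e k) ≤ linSpan (yPts r θ x₀ e l) := by
  rw [linSpan_le_iff]
  rintro _ ⟨i, hi, rfl⟩
  exact ⟨yPt_mem_linSpan (hi.trans h), Submodule.zero_mem _⟩

theorem lor_eq_of_mem_linSpan_yPts {a b v : Vec d} {k : ℕ}
    (h : ∀ i ≤ k, lor a (yPt r θ x₀ e i).coords = lor b (yPt r θ x₀ e i).coords)
    (hv : v ∈ linSpan (yPts r θ x₀ e k)) : lor a v = lor b v := by
  refine Submodule.span_induction (p := fun v _ => lor a v = lor b v) ?_ ?_ ?_ ?_ hv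
  · rintro _ (⟨_, ⟨i, hi, rfl⟩, rfl⟩ | ⟨_, ⟨i, hi, rfl⟩, rfl⟩)
    · exact h i hi
    · simp [lor_zero_right]
  · simp [lor_zero_right]
  · intro x y _ _ hx hy
    rw [lor_add_right, lor_add_right, hx, hy]
  · intro c x _ hx
    rw [lor_smul_right, lor_smul_right, hx]

theorem lor_frameVec_of_mem_linSpan (he : ∀ i j, tinner (e i) (e j) = if i = j then 1 else 0)
    {k : ℕ} (hk : k < d) {v : Vec d} (hv : v ∈ linSpan (yPts r θ x₀ e k)) :
    lor (frameVec e k : Vec d) v = 0 := by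
  rw [← lor_zero_left v]
  refine lor_eq_of_mem_linSpan_yPts (fun i hi => ?_) hv
  rw [lor_zero_left, lor_comm, lor_yPt_frameVec_of_le he hi hk]

theorem frameVec_mem_linSpan (hr : 0 < r) (hθ : θ ∈ Set.Ioo 0 (Real.pi / 2))
    (he : ∀ i j, tinner (e i) (e j) = if i = j then 1 else 0) {k : ℕ} (hk : k < d) :
    (frameVec e k : Vec d) ∈ linSpan (yPts r θ x₀ e (k + 1)) := by
  have hs := (Real.sinh_pos_iff.2 (stepLen_pos hr hθ k)).ne'
  have h := yPt_succ (x₀ := x₀) hr hθ he hk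
  have h1 : (frameVec e k : Vec d) = (1 / Real.sinh (stepLen r θ k)) •
      ((yPt r θ x₀ e (k + 1)).coords - Real.cosh (stepLen r θ k) • (yPt r θ x₀ e k).coords) := by
    rw [h, add_sub_cancel_left, smul_smul, one_div_mul_cancel hs, one_smul]
  rw [h1]
  exact Submodule.smul_mem _ _ (Submodule.sub_mem _ (yPt_mem_linSpan le_rfl)
    (Submodule.smul_mem _ _ (yPt_mem_linSpan (Nat.le_succ k))))

/-- The point `y_k` is, up to the factor `cosh r_k`, the projection of each point of `S_k` to the
span of `y₀, …, y_k`. -/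
theorem lor_xs_of_mem_linSpan (hr : 0 < r) (hθ : θ ∈ Set.Ioo 0 (Real.pi / 2))
    (he : ∀ i j, tinner (e i) (e j) = if i = j then 1 else 0) {xs : Hyp d} {k : ℕ} (hk : k ≤ d)
    (hxs : xs ∈ sphereSet r θ x₀ e k) {v : Vec d} (hv : v ∈ linSpan (yPts r θ x₀ e k)) :
    lor xs.coords v = Real.cosh (radius r θ k) * lor (yPt r θ x₀ e k).coords v := by
  obtain ⟨h0, h⟩ := (mem_sphereSet_iff hr hθ he hk).1 hxs
  rw [← lor_smul_left]
  refine lor_eq_of_mem_linSpan_yPts (fun i hi => ?_) hv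
  rw [lor_smul_left, cosh_mul_lor_yPt_yPt hr hθ he hk hi, lor_comm, lor_eq_neg_cosh_hdist,
    hdist_yPt_of_lor hr hθ he (hi.trans hk) h0 fun j hj => h j (by omega)]

/-- Pythagoras again: `cosh dist(x, x*) = cosh r_k cosh dist(y_k, x)`, so `y_k` is the point of the
gspan nearest to `x*`. -/
theorem radius_le_hdist (hr : 0 < r) (hθ : θ ∈ Set.Ioo 0 (Real.pi / 2))
    (he : ∀ i j, tinner (e i) (e j) = if i = j then 1 else 0) {xs x : Hyp d} {k : ℕ} (hk : k ≤ d)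
    (hxs : xs ∈ sphereSet r θ x₀ e k) (hx : x ∈ gspan (yPts r θ x₀ e k)) :
    radius r θ k ≤ hdist x xs := by
  apply le_hdist_of_cosh_le
  rw [lor_comm, lor_xs_of_mem_linSpan hr hθ he hk hxs hx]
  nlinarith [Real.cosh_pos (radius r θ k), one_le_neg_lor (yPt r θ x₀ e k) x]

/-- The next frame vector and `x* - cosh r_k y_k` are both orthogonal to the span. Thus the gspan
lies in the boundary of `L_k`, where the distance to `L_k` has many subgradients. -/
theorem lor_normalVec_of_mem_gspan (hr : 0 < r) (hθ : θ ∈ Set.Ioo 0 (Real.pi / 2))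
    (he : ∀ i j, tinner (e i) (e j) = if i = j then 1 else 0) {xs x : Hyp d} {k : ℕ} (hk : k < d)
    (hxs : xs ∈ sphereSet r θ x₀ e k) (hx : x ∈ gspan (yPts r θ x₀ e k)) :
    lor (normalVec r θ x₀ e xs k : Vec d) x.coords = 0 := by
  rw [normalVec_coords hr hθ he hk hxs, lor_sub_left, lor_smul_left, lor_smul_left, lor_sub_left,
    lor_smul_left, lor_xs_of_mem_linSpan hr hθ he hk.le hxs hx,
    lor_frameVec_of_mem_linSpan he hk hx]
  ring

theorem sphereSet_antitone : Antitone (sphereSet r θ x₀ e) :=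
  antitone_nat_of_succ_le fun _ _ hx => hx.1

/-! ### The hard function -/

theorem le_baseFun {xs : Hyp d} (x : Hyp d) (i : Fin (d - 1)) :
    hdist x xs + (1 / Real.cos θ) * hdistSet x (halfSpace r θ x₀ e xs i) ≤
      baseFun r θ x₀ e xs x :=
  add_le_add_right (le_ciSup (f := fun i : Fin (d - 1) =>
    (1 / Real.cos θ) * hdistSet x (halfSpace r θ x₀ e xs i)) (Set.finite_range _).bddAbove i) _

theorem hdist_le_baseFun (hθ : θ ∈ Set.Ioo 0 (Real.pi / 2)) {xs : Hyp d} (x : Hyp d) :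
    hdist x xs ≤ baseFun r θ x₀ e xs x :=
  le_add_of_nonneg_right (Real.iSup_nonneg fun _ =>
    mul_nonneg (one_div_nonneg.2 (cos_pos_of_mem hθ).le) (hdistSet_nonneg _ _))

theorem baseFun_eq_hdist {xs x : Hyp d}
    (h : ∀ i < d - 1, x ∈ halfSpace r θ x₀ e xs i) : baseFun r θ x₀ e xs x = hdist x xs := by
  have : ∀ i : Fin (d - 1), (1 / Real.cos θ) * hdistSet x (halfSpace r θ x₀ e xs i) = 0 :=
    fun i => by rw [hdistSet_eq_zero (h i i.2), mul_zero]
  simp only [baseFun, this, Real.iSup_const_zero, add_zero]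

theorem mem_subdiff_const_mul {f : Hyp d → ℝ} {x : Hyp d} {g : Tan x} {c : ℝ} (hc : 0 ≤ c)
    (hg : g ∈ subdiff f x) : c • g ∈ subdiff (fun y => c * f y) x := by
  intro y
  rw [tinner_smul_left]
  have := mul_le_mul_of_nonneg_left (hg y) hc
  linarith

/-- A subgradient of an active term of the maximum is one of the whole function. -/
theorem add_mem_subdiff_baseFun (hθ : θ ∈ Set.Ioo 0 (Real.pi / 2)) {xs x : Hyp d}
    {i : Fin (d - 1)} {g₁ g₂ : Tan x} (h₁ : g₁ ∈ subdiff (fun y => hdist y xs) x)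
    (h₂ : g₂ ∈ subdiff (fun y => hdistSet y (halfSpace r θ x₀ e xs i)) x)
    (hi : baseFun r θ x₀ e xs x ≤
      hdist x xs + (1 / Real.cos θ) * hdistSet x (halfSpace r θ x₀ e xs i)) :
    g₁ + (1 / Real.cos θ) • g₂ ∈ subdiff (baseFun r θ x₀ e xs) x := by
  intro y
  have h1 := h₁ y
  have h2 := mem_subdiff_const_mul (one_div_nonneg.2 (cos_pos_of_mem hθ).le) h₂ y
  have h3 := le_baseFun (r := r) (θ := θ) (x₀ := x₀) (e := e) (xs := xs) y i
  rw [tinner_add_left]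
  simp only at h1 h2
  linarith

theorem exists_mem_subdiff_baseFun (hr : 0 < r) (hθ : θ ∈ Set.Ioo 0 (Real.pi / 2))
    (he : ∀ i j, tinner (e i) (e j) = if i = j then 1 else 0) {xs : Hyp d}
    (hxs : xs ∈ sphereSet r θ x₀ e (d - 1)) (x : Hyp d) :
    ∃ g ∈ subdiff (baseFun r θ x₀ e xs) x,
      ∀ y, |tinner g (hlog x y)| ≤ (1 + 1 / Real.cos θ) * hdist x y := by
  have hc : 0 < 1 / Real.cos θ := one_div_pos.2 (cos_pos_of_mem hθ)
  obtain ⟨g₁, h₁, hg₁⟩ := exists_mem_subdiff_hdist x xs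
  -- For `d ≤ 1` the supremum is over the empty type and equals `0`.
  rcases isEmpty_or_nonempty (Fin (d - 1)) with hE | hE
  · refine ⟨g₁, fun y => ?_, fun y => ?_⟩
    · simpa [baseFun] using h₁ y
    · refine (abs_tinner_hlog_le y hg₁).trans ?_
      have := mul_nonneg hc.le (hdist_nonneg x y)
      linarith
  · obtain ⟨i, hi⟩ := exists_eq_ciSup_of_finite (f := fun i : Fin (d - 1) =>
      (1 / Real.cos θ) * hdistSet x (halfSpace r θ x₀ e xs i))
    have hid : (i : ℕ) < d := by have := i.2; omega
    have hxi : xs ∈ sphereSet r θ x₀ e (i + 1) :=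
      sphereSet_antitone (by have := i.2; omega : (i : ℕ) + 1 ≤ d - 1) hxs
    obtain ⟨g₂, h₂, hg₂⟩ := exists_mem_subdiff_hdistSet (lor_unitNormal_self hr hθ he hid hxi) x
    rw [← halfSpace_eq_halfSpaceOf hθ] at h₂
    refine ⟨_, add_mem_subdiff_baseFun hθ h₁ h₂ ?_, fun y => ?_⟩
    · rw [baseFun, ← hi]
    · rw [tinner_add_left, tinner_smul_left]
      refine (abs_add_le _ _).trans ?_
      rw [abs_mul, abs_of_pos hc, add_mul, one_mul]
      exact add_le_add (abs_tinner_hlog_le y hg₁)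
        (mul_le_mul_of_nonneg_left (abs_tinner_hlog_le y hg₂) hc.le)

theorem mem_halfSpace_of_mem_gspan (hr : 0 < r) (hθ : θ ∈ Set.Ioo 0 (Real.pi / 2))
    (he : ∀ i j, tinner (e i) (e j) = if i = j then 1 else 0) {xs x : Hyp d} {k i : ℕ}
    (hki : k ≤ i) (hi : i < d) (hxs : xs ∈ sphereSet r θ x₀ e i)
    (hx : x ∈ gspan (yPts r θ x₀ e k)) : x ∈ halfSpace r θ x₀ e xs i := by
  rw [halfSpace_eq]
  exact (lor_normalVec_of_mem_gspan hr hθ he hi hxs (linSpan_yPts_mono hki hx)).ge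

/-- At the points that the algorithm can have reached there is a subgradient which reveals only the
next point `y_{k+1}`. -/
theorem exists_mem_subdiff_baseFun_linSpan (hr : 0 < r) (hθ : θ ∈ Set.Ioo 0 (Real.pi / 2))
    (he : ∀ i j, tinner (e i) (e j) = if i = j then 1 else 0) {xs : Hyp d}
    (hxs : xs ∈ sphereSet r θ x₀ e (d - 1)) {k : ℕ} (hk : k + 2 ≤ d) {x : Hyp d}
    (hx : x ∈ gspan (yPts r θ x₀ e k)) (hxL : ∀ l < k, x ∈ halfSpace r θ x₀ e xs l) :
    ∃ g ∈ subdiff (baseFun r θ x₀ e xs) x, (g : Vec d) ∈ linSpan (yPts r θ x₀ e (k + 1)) := by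
  have hkd : k < d := by omega
  have hxs' : ∀ i ≤ d - 1, xs ∈ sphereSet r θ x₀ e i := fun i hi => sphereSet_antitone hi hxs
  have hxk := hxs' k (by omega)
  -- Terms `i < k` vanish by hypothesis, terms `i ≥ k` because `x` lies on the boundary of `L_i`. So
  -- every term is active, in particular `i = k`.
  have hbase : baseFun r θ x₀ e xs x = hdist x xs := by
    refine baseFun_eq_hdist fun i hi => ?_
    rcases lt_or_ge i k with h | h
    · exact hxL i h
    · exact mem_halfSpace_of_mem_gspan hr hθ he h (by omega) (hxs' i hi.le) hx
  have hD := radius_le_hdist hr hθ he hkd.le hxk hx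
  have hρ := radius_pos hr (sin_pos_of_mem hθ) k
  have hV := lor_normalVec_of_mem_gspan hr hθ he hkd hxk hx
  have hVc := normalVec_coords hr hθ he hkd hxk
  set V : Vec d := (normalVec r θ x₀ e xs k : Vec d) with hVdef
  have hn1 := lor_unitNormal_self hr hθ he hkd (hxs' (k + 1) (by omega))
  have hnx : lor (unitNormal r θ x₀ e xs k) x.coords = 0 := by
    rw [unitNormal, lor_smul_left, ← hVdef, hV, mul_zero]
  obtain ⟨w, hw, hw1, -, hp, -⟩ := exists_polar x xs
  set D := hdist x xs
  have hDpos : 0 < D := hρ.trans_le hD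
  have hsD := Real.sinh_pos_iff.2 hDpos
  have hsρ := Real.sinh_pos_iff.2 hρ
  have hcos := cos_pos_of_mem hθ
  have hsin := sin_pos_of_mem hθ
  -- The weight that removes `x*`: the sum below is `-w - q V_k`, where `x*` has coefficient `-1 /
  -- sinh D` in `-w` and `q / sinh r_k` in `-q V_k`. It is admissible, `q ≤ 1`, because `D ≥ r_k`.
  set q := Real.sinh (radius r θ k) / Real.sinh D with hq
  have hq0 : 0 ≤ q := div_nonneg hsρ.le hsD.le
  have hq1 : q ≤ 1 := by
    rw [hq, div_le_one hsD]; exact Real.sinh_le_sinh.2 hD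
  let g₁ : Tan x := ⟨-w, by rw [mem_Tan, lor_neg_right, hw, neg_zero]⟩
  let g₂ : Tan x := ⟨-((q * Real.sin θ) • unitNormal r θ x₀ e xs k), by
    rw [mem_Tan, lor_neg_right, lor_smul_right, lor_comm, hnx]; ring⟩
  have h₁ : g₁ ∈ subdiff (fun y => hdist y xs) x := mem_subdiff_hdist hw hw1 hp rfl
  have h₂ : g₂ ∈ subdiff (fun y => hdistSet y (halfSpace r θ x₀ e xs k)) x := by
    rw [halfSpace_eq_halfSpaceOf hθ]
    exact mem_subdiff_hdistSet_of_boundary hn1 hnx (mul_nonneg hq0 hsin.le)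
      (mul_le_one₀ hq1 hsin.le (Real.sin_le_one θ)) rfl
  refine ⟨g₁ + (1 / Real.cos θ) • g₂, add_mem_subdiff_baseFun (i := ⟨k, by omega⟩) hθ h₁ h₂ ?_, ?_⟩
  · rw [hbase]
    exact le_add_of_nonneg_right (mul_nonneg (one_div_pos.2 hcos).le (hdistSet_nonneg _ _))
  · have hwe : w = (1 / Real.sinh D) • (xs.coords - Real.cosh D • x.coords) := by
      rw [hp, add_sub_cancel_left, smul_smul, one_div_mul_cancel hsD.ne', one_smul]
    have hsum : ((g₁ + (1 / Real.cos θ) • g₂ : Tan x) : Vec d) =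
        (Real.cosh D / Real.sinh D) • x.coords - (q / Real.cos θ) • (frameVec e k : Vec d) -
          (Real.cosh (radius r θ k) / Real.sinh D) • (yPt r θ x₀ e k).coords := by
      change -w + (1 / Real.cos θ) • -((q * Real.sin θ) • unitNormal r θ x₀ e xs k) = _
      rw [unitNormal, ← hVdef, hVc, hwe, hq]
      match_scalars <;> field_simp
      ring
    rw [hsum]
    refine Submodule.sub_mem _ (Submodule.sub_mem _ (Submodule.smul_mem _ _ ?_)
      (Submodule.smul_mem _ _ (frameVec_mem_linSpan hr hθ he hkd)))
      (Submodule.smul_mem _ _ (yPt_mem_linSpan (Nat.le_succ k)))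
    exact linSpan_yPts_mono (Nat.le_succ k) hx

/-- One subgradient has to serve all admissible `k` at once; the one for the smallest such `k` does,
as the spans increase. -/
theorem exists_oracle_value (hr : 0 < r) (hθ : θ ∈ Set.Ioo 0 (Real.pi / 2))
    (he : ∀ i j, tinner (e i) (e j) = if i = j then 1 else 0) {xs : Hyp d}
    (hxs : xs ∈ sphereSet r θ x₀ e (d - 1)) (x : Hyp d) :
    ∃ g ∈ subdiff (baseFun r θ x₀ e xs) x, ∀ k, k + 2 ≤ d → x ∈ gspan (yPts r θ x₀ e k) →
      (∀ l < k, x ∈ halfSpace r θ x₀ e xs l) →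
      (g : Vec d) ∈ linSpan (yPts r θ x₀ e (k + 1)) := by
  classical
  by_cases h : ∃ k, k + 2 ≤ d ∧ x ∈ gspan (yPts r θ x₀ e k) ∧
      ∀ l < k, x ∈ halfSpace r θ x₀ e xs l
  · obtain ⟨h1, h2, h3⟩ := Nat.find_spec h
    obtain ⟨g, hg, hgs⟩ := exists_mem_subdiff_baseFun_linSpan hr hθ he hxs h1 h2 h3
    refine ⟨g, hg, fun k hk hx hxL => linSpan_yPts_mono ?_ hgs⟩
    exact Nat.succ_le_succ (Nat.find_min' h ⟨hk, hx, hxL⟩)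
  · obtain ⟨g, hg, -⟩ := exists_mem_subdiff_baseFun hr hθ he hxs x
    exact ⟨g, hg, fun k hk hx hxL => absurd ⟨k, hk, hx, hxL⟩ h⟩

/-- If the oracle reveals one new point `y_{k+1}` at a time, then the `k`-th query stays in the
span of `y₀, …, y_k`. -/
theorem iter_mem_gspan_yPts {f : Hyp d → ℝ} {xs : Hyp d} {O : Hyp d → ℝ × TBundle d}
    (hO : IsOracle f O)
    (hspan : ∀ k, k + 2 ≤ d → ∀ x ∈ gspan (yPts r θ x₀ e k),
      (∀ l < k, x ∈ halfSpace r θ x₀ e xs l) →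
      ((O x).2.2 : Vec d) ∈ linSpan (yPts r θ x₀ e (k + 1)))
    {A : Algorithm d} (h1 : QueriesInGspan x₀ A O) (h2 : QueriesInHalfSpaces r θ x₀ e xs A O)
    (k : ℕ) (hk : k < d) : iter A O k ∈ gspan (yPts r θ x₀ e k) := by
  induction k using Nat.strong_induction_on with
  | _ k ih =>
    rcases Nat.eq_zero_or_pos k with rfl | hpos
    · rw [h1.1]
      exact yPt_mem_linSpan (r := r) (θ := θ) (x₀ := x₀) (e := e) le_rfl
    · refine (linSpan_le_iff.2 ?_ : linSpan _ ≤ linSpan (yPts r θ x₀ e k)) (h1.2 k hpos)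
      rintro _ ⟨l, hl, rfl⟩
      have hl' : l < k := hl
      have hmem := ih l hl' (by omega)
      constructor
      · obtain ⟨g, -, hg⟩ := hO (iter A O l)
        simp only [hg]
        exact linSpan_yPts_mono hl'.le hmem
      -- From `l < k < d` follows `l + 2 ≤ d`: the answer at the query `d - 1` is never used.
      · exact linSpan_yPts_mono hl' (hspan l (by omega) _ hmem (h2 l (by omega)))

end HypOpt

/-! ### The lower bound. -/

theorem theorem5 (r M ε θ : ℝ) (hr : 0 < r) (hM : 0 < M)
    (hε : ε ≤ 1 / (4 * Real.sqrt 2))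
    (hθ : θ ∈ Set.Ioo 0 (Real.pi / 2)) (hεθ : ε = Real.cos θ / 4)
    (d : ℕ) (hd : d = ⌊HypOpt.zeta r / (32 * ε ^ 2)⌋₊)
    (x₀ : HypOpt.Hyp d) (e : Fin d → HypOpt.Tan x₀)
    (he : ∀ i j, HypOpt.tinner (e i) (e j) = if i = j then 1 else 0) :
    (HypOpt.sphereSet r θ x₀ e (d - 1)).Nonempty ∧
    ∀ xs ∈ HypOpt.sphereSet r θ x₀ e (d - 1),
      HypOpt.GConvex (HypOpt.hardFun M r θ x₀ e xs) ∧
      HypOpt.GLipschitz M (HypOpt.hardFun M r θ x₀ e xs) ∧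
      IsLeast (Set.range (HypOpt.hardFun M r θ x₀ e xs)) (HypOpt.hardFun M r θ x₀ e xs xs) ∧
      ∃ O : HypOpt.Hyp d → ℝ × HypOpt.TBundle d,
        HypOpt.IsOracle (HypOpt.hardFun M r θ x₀ e xs) O ∧
        (∀ k, k + 2 ≤ d → ∀ x ∈ HypOpt.gspan (HypOpt.yPts r θ x₀ e k),
          (∀ l < k, x ∈ HypOpt.halfSpace r θ x₀ e xs l) →
          ((O x).2.2 : HypOpt.Vec d) ∈ HypOpt.linSpan (HypOpt.yPts r θ x₀ e (k + 1))) ∧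
        ∀ A : HypOpt.Algorithm d,
          HypOpt.QueriesInGspan x₀ A O →
          HypOpt.QueriesInHalfSpaces r θ x₀ e xs A O →
          ∀ k < d,
            ε * M * r ≤ HypOpt.hardFun M r θ x₀ e xs (HypOpt.iter A O k)
              - HypOpt.hardFun M r θ x₀ e xs xs := by
  open HypOpt in
  have hcos := cos_pos_of_mem hθ
  have hc2 : Real.cos θ ^ 2 ≤ 1 / 2 := by
    have h2 : 0 < √2 := by positivity
    have h1 : Real.cos θ * √2 ≤ 1 := by
      rw [hεθ, div_le_div_iff₀ (by norm_num) (by positivity)] at hε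
      linarith
    have h3 : (Real.cos θ * √2) ^ 2 ≤ 1 := pow_le_one₀ (by positivity) h1
    rw [mul_pow, Real.sq_sqrt (by norm_num)] at h3
    linarith
  have hε2 : 32 * ε ^ 2 = 2 * Real.cos θ ^ 2 := by rw [hεθ]; ring
  have hε2pos : 0 < 2 * Real.cos θ ^ 2 := by positivity
  have hz := one_le_zeta hr
  rw [hε2] at hd
  have hd1 : 1 ≤ d := by
    rw [hd, Nat.one_le_floor_iff, le_div_iff₀ hε2pos]
    linarith
  have hdz : d * (2 * Real.cos θ ^ 2) ≤ zeta r := by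
    rw [← le_div_iff₀ hε2pos, hd]
    exact Nat.floor_le (by positivity)
  refine ⟨sphereSet_nonempty hr hθ he (by omega), fun xs hxs => ?_⟩
  have hs : 0 ≤ M * Real.cos θ / 2 := by positivity
  have hsub : ∀ x, ∃ g ∈ subdiff (hardFun M r θ x₀ e xs) x,
      ∀ y, |tinner g (hlog x y)| ≤ M * hdist x y := by
    intro x
    obtain ⟨g, hg, hgM⟩ := exists_mem_subdiff_baseFun hr hθ he hxs x
    refine ⟨_, mem_subdiff_const_mul hs hg, fun y => ?_⟩
    rw [tinner_smul_left, abs_mul, abs_of_nonneg hs]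
    -- The two parts of the subgradient have norms at most `1` and `1 / cos θ`; the scaling turns
    -- the sum into `M (1 + cos θ) / 2 ≤ M`.
    calc _ ≤ M * Real.cos θ / 2 * ((1 + 1 / Real.cos θ) * hdist x y) := by
          gcongr; exact hgM y
      _ = M * ((Real.cos θ + 1) / 2) * hdist x y := by field_simp
      _ ≤ M * 1 * hdist x y := by
          gcongr
          · exact hdist_nonneg x y
          · linarith [Real.cos_le_one θ]
      _ = M * hdist x y := by rw [mul_one]
  have hbase : baseFun r θ x₀ e xs xs = 0 := by
    rw [baseFun_eq_hdist, hdist_self]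
    intro i hi
    rw [halfSpace_eq]
    exact (lor_normalVec_xs hr hθ he (by omega)
      (sphereSet_antitone (by omega : i + 1 ≤ d - 1) hxs)).ge
  have hmin : hardFun M r θ x₀ e xs xs = 0 := by rw [hardFun, hbase, mul_zero]
  refine ⟨GConvex.of_subdiff_nonempty fun x => ?_, GLipschitz.of_subdiff hsub, ⟨⟨xs, rfl⟩, ?_⟩, ?_⟩
  · obtain ⟨g, hg, -⟩ := hsub x
    exact ⟨g, hg⟩
  · rintro _ ⟨x, rfl⟩
    rw [hmin]
    exact mul_nonneg hs ((hdist_nonneg x xs).trans (hdist_le_baseFun hθ x))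
  · choose G hG hGs using exists_oracle_value hr hθ he hxs
    let O : Hyp d → ℝ × TBundle d := fun x =>
      (hardFun M r θ x₀ e xs x, ⟨x, (M * Real.cos θ / 2) • G x⟩)
    have hO : IsOracle (hardFun M r θ x₀ e xs) O := fun x =>
      ⟨_, mem_subdiff_const_mul hs (hG x), rfl⟩
    have hspan : ∀ k, k + 2 ≤ d → ∀ x ∈ gspan (yPts r θ x₀ e k),
        (∀ l < k, x ∈ halfSpace r θ x₀ e xs l) →
        ((O x).2.2 : Vec d) ∈ linSpan (yPts r θ x₀ e (k + 1)) := fun k hk x hx hxL =>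
      Submodule.smul_mem _ _ (hGs x k hk hx hxL)
    refine ⟨O, hO, hspan, fun A h1 h2 k hk => ?_⟩
    have hmem := iter_mem_gspan_yPts hO hspan h1 h2 k hk
    have hdist := radius_le_hdist hr hθ he hk.le
      (sphereSet_antitone (by omega : k ≤ d - 1) hxs) hmem
    have hrad : r / 2 ≤ radius r θ k := by
      refine half_le_radius hr (sin_pos_of_mem hθ) hc2 (le_trans ?_ hdz)
      gcongr
    rw [hmin, sub_zero, hardFun]
    -- Half of the initial radius survives, and `ε = cos θ / 4` absorbs this factor and the `1/2` of
    -- the scaling.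
    calc ε * M * r = M * Real.cos θ / 2 * (r / 2) := by rw [hεθ]; ring
      _ ≤ _ := mul_le_mul_of_nonneg_left
        (hrad.trans (hdist.trans (hdist_le_baseFun hθ _))) hs
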